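/- Let $\alpha\in(0,\frac{\pi}{2}]$, $c_0>0$ and $c=c_0/\sin\alpha$. Consider on $\mathbb R^2$ the forced mean curvature equation $$-\operatorname{div}\Big(\frac{D\phi}{\sqrt{1+|D\phi|^2}}\Big)+c_0-\frac{c}{\sqrt{1+|D\phi|^2}}=0. \qquad (1)$$ Call $\phi:\mathbb R^2\to\mathbb R$ a radial cone solution if $\phi(x)=\phi(|x|)$ is radially symmetric, is of class $C^2$ and satisfies (1) on $\mathbb R^2\setminus\{0\}$, satisfies $\phi'(0)=0$ as a function of $r=|x|\ge 0$ (one-sided derivative), and satisfies $\phi(x)=-(\cot\alpha)|x|+o(|x|)$ as $|x|\to\infty$. Then the following hold. 1. A radial cone solution $\phi_c$ exists, and any two radial cone solutions differ by an additive constant. 2. Every radial cone solution $\phi_c$ is $C^\infty$ on $\mathbb R^2$, satisfies (1) on all of $\mathbb R^2$, is concave, and satisfies $|D\phi_c|\le\cot\alpha$ on $\mathbb R^2$. 3. If $\alpha=\frac{\pi}{2}$, every radial cone solution is constant. 4. If $\alpha\ne\frac{\pi}{2}$, then for every radial cone solution $\phi_c$ there is a constant $C\in\mathbb R$ such that, as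 $|x|\to\infty$, $$\phi_c(x)=-(\cot\alpha)|x|+\frac{1}{c_0\sin\alpha}\ln|x|+C+\frac{2-3\sin^2\alpha}{c_0^2\sin(2\alpha)\,|x|}+O\Big(\frac1{|x|^2}\Big). \qquad (2)$$ 5. Let $\alpha\neq\frac{\pi}{2}$ and $$\phi_*(x)=-\frac{2}{c_0\sin\alpha}\ln\Big(\int_{\mathbb S^1}e^{\frac{c_0\cos\alpha}{2}x\cdot\nu}\,d\mu(\nu)\Big),$$ where $\mu=\frac{d\theta}{2\pi}$ is the uniform probability measure on the unit circle $\mathbb S^1$. There is a radial cone solution $\phi_c$ satisfying (2) with $C=C_0:=\frac{\ln(\pi c_0\cos\alpha)}{c_0\sin\alpha}$, and for it $\phi_c(x)\ge\phi_*(x)$ for every $x\in\mathbb R^2$, and $\phi_c(x)=\phi_*(x)+O(|x|^{-1/2})$ as $|x|\to\infty$. -/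

import Mathlib

namespace ForcedMC

/-- The divergence `∑ i, ∂ᵢ Fᵢ` of a vector field on `ℝⁿ`. -/
noncomputable def divergence {n : ℕ}
    (F : EuclideanSpace ℝ (Fin n) → EuclideanSpace ℝ (Fin n))
    (x : EuclideanSpace ℝ (Fin n)) : ℝ :=
  ∑ i, (fderiv ℝ F x (EuclideanSpace.single i 1)) i

/-- The forced mean curvature operator
`-div (Dφ / √(1 + |Dφ|²)) + c₀ - c / √(1 + |Dφ|²)`. -/
noncomputable def mcmOperator {n : ℕ} (c₀ c : ℝ) (φ : EuclideanSpace ℝ (Fin n) → ℝ)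
    (x : EuclideanSpace ℝ (Fin n)) : ℝ :=
  -divergence (fun y => (1 / Real.sqrt (1 + ‖gradient φ y‖ ^ 2)) • gradient φ y) x
    + c₀ - c / Real.sqrt (1 + ‖gradient φ x‖ ^ 2)

/-- `φ` is a classical (`C²`) solution of the forced mean curvature equation on the
open set `U`. -/
def IsSolutionOn {n : ℕ} (c₀ c : ℝ) (φ : EuclideanSpace ℝ (Fin n) → ℝ)
    (U : Set (EuclideanSpace ℝ (Fin n))) : Prop :=
  ContDiffOn ℝ 2 φ U ∧ ∀ x ∈ U, mcmOperator c₀ c φ x = 0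

/-- `φ` is a function of `r = |x|` alone and, as a function of `r ≥ 0`, satisfies
`φ'(0) = 0`. -/
def IsRadialWithZeroSlope {n : ℕ} (φ : EuclideanSpace ℝ (Fin n) → ℝ) : Prop :=
  ∃ f : ℝ → ℝ, (∀ x, φ x = f ‖x‖) ∧ HasDerivWithinAt f 0 (Set.Ici 0) 0

/-- `φ(x) = -(cot α) |x| + o(|x|)` as `|x| → ∞`. -/
def IsAsymptoticToCone {n : ℕ} (α : ℝ) (φ : EuclideanSpace ℝ (Fin n) → ℝ) : Prop :=
  Asymptotics.IsLittleO (Bornology.cobounded (EuclideanSpace ℝ (Fin n)))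
    (fun x => φ x - (-Real.cot α * ‖x‖)) (fun x => ‖x‖)

/-- A radially symmetric solution on `ℝ²` with `φ'(0) = 0`, asymptotic to the straight cone.
As for the radial ordinary differential equation on `r > 0`, only `C²` regularity and the
equation away from the origin are required here; at the origin only `φ'(0) = 0` is. -/
structure IsRadialConeSolution (α c₀ c : ℝ) (φ : EuclideanSpace ℝ (Fin 2) → ℝ) : Prop where
  solution : IsSolutionOn c₀ c φ {0}ᶜ
  radial : IsRadialWithZeroSlope φ
  asymptotic : IsAsymptoticToCone α φ

/-- `φ(x) = -(cot α)|x| + ln|x| / (c₀ sin α) + C + (2 - 3 sin² α) / (c₀² sin(2α) |x|)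
+ O(1/|x|²)` as `|x| → ∞`. -/
def HasConeExpansion (α c₀ C : ℝ) (φ : EuclideanSpace ℝ (Fin 2) → ℝ) : Prop :=
  Asymptotics.IsBigO (Bornology.cobounded (EuclideanSpace ℝ (Fin 2)))
    (fun x => φ x - (-Real.cot α * ‖x‖ + 1 / (c₀ * Real.sin α) * Real.log ‖x‖ + C
      + (2 - 3 * Real.sin α ^ 2) / (c₀ ^ 2 * Real.sin (2 * α) * ‖x‖)))
    (fun x => 1 / ‖x‖ ^ 2)

/-- The sub-solution attached to a measure `μ` on the unit sphere:
`φ_*(x) = -2 / (c₀ sin α) ln ∫ exp ((c₀ cos α / 2) x · ν) dμ(ν)`. -/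
noncomputable def phiStar {n : ℕ} (α c₀ : ℝ)
    (μ : MeasureTheory.Measure (Metric.sphere (0 : EuclideanSpace ℝ (Fin n)) 1))
    (x : EuclideanSpace ℝ (Fin n)) : ℝ :=
  -(2 / (c₀ * Real.sin α)) *
    Real.log (∫ ν, Real.exp (c₀ * Real.cos α / 2 * inner ℝ x (ν : EuclideanSpace ℝ (Fin n))) ∂μ)

/-- The point `(cos θ, sin θ)` of the unit circle. -/
noncomputable def circlePoint (θ : ℝ) : Metric.sphere (0 : EuclideanSpace ℝ (Fin 2)) 1 :=
  ⟨!₂[Real.cos θ, Real.sin θ], by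
    simp [EuclideanSpace.norm_eq, Fin.sum_univ_two]⟩

/-- The measure `dθ / 2π` on the unit circle. -/
noncomputable def uniformCircle :
    MeasureTheory.Measure (Metric.sphere (0 : EuclideanSpace ℝ (Fin 2)) 1) :=
  ENNReal.ofReal (1 / (2 * Real.pi)) •
    MeasureTheory.Measure.map circlePoint
      (MeasureTheory.volume.restrict (Set.Ico 0 (2 * Real.pi)))

end ForcedMC

namespace ForcedMC

open Set Filter Topology MeasureTheory Asymptotics
open scoped ContDiff

local notation "E" => EuclideanSpace ℝ (Fin 2)

/-! For a radial profile `f`, let `s = -f' / √(1 + f'²)` be the sine of its angle and `q = r s` the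
flux. The equation becomes `q' = r (c √(1 - s²) - c₀)`. Write `k = cos α`, `σ = sin α`; since `c σ =
c₀`, the forcing vanishes exactly at the cone angle `s = k`.

In terms of `q` the origin is harmless: as long as `|s|` stays away from `1`, the right-hand side is
Lipschitz in `q` with a constant independent of `r`. Existence follows by clipping `s` to `[0, k]`
and showing by comparison that the clip never acts. Uniqueness holds because `|q| < r` already
forces `q / r → 0` at the origin (`flux_unique`). As solutions are unique up to constants, every
claim needs proof for one solution only.

That solution is smooth at the origin because `s(r) = r p(r²)` with `p` smooth up to `0`
(`exists_profile`). The bound `s ≤ k` is the gradient bound, and it makes the solution constant when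
`k = 0`. Dilations `s(l r)` with `l ≥ 1` are super-solutions, so `s` is nondecreasing, which gives
concavity.

If `k > 0`, the equation contracts towards a formal expansion of `s` in `1 / r`. The error is
`O(r⁻³)` (`sine_expansion`); passing to slopes and integrating gives (2).

For the uniform measure, `φ_*` is a multiple of `ln I₀`, with slope proportional to `I₁ / I₀`. The
Riccati equation of this ratio and Cauchy–Schwarz make its sine a sub-solution, so `φ_c - φ_*` is
nonincreasing in `r` (`besselRatio_le_slopeOf`). Laplace's method identifies `C₀` as the constant
for which this difference tends to `0`; hence it is nonnegative. -/

/-! ### Scalar differential equations: comparison and global existence. -/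

/-- A function starting at a nonnegative value whose derivative is nonnegative wherever the
function is negative stays nonnegative. -/
theorem nonneg_of_deriv_nonneg_of_neg {d d' : ℝ → ℝ} {a : ℝ} (hc : ContinuousOn d (Ici a))
    (hd : ∀ r, a < r → HasDerivAt d (d' r) r) (h0 : 0 ≤ d a)
    (h : ∀ r, a < r → d r < 0 → 0 ≤ d' r) {r : ℝ} (hr : a ≤ r) : 0 ≤ d r := by
  by_contra! hneg
  have hcI : ContinuousOn d (Icc a r) := hc.mono Icc_subset_Ici_self
  have hcomp : IsCompact (Icc a r ∩ d ⁻¹' Ici 0) :=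
    isCompact_Icc.of_isClosed_subset (hcI.preimage_isClosed_of_isClosed isClosed_Icc isClosed_Ici)
      inter_subset_left
  obtain ⟨x, ⟨⟨hax, hxr⟩, hx0⟩, hmax⟩ := hcomp.exists_isGreatest ⟨a, ⟨le_rfl, hr⟩, h0⟩
  have hx0' : 0 ≤ d x := hx0
  have hlt : ∀ y ∈ Ioc x r, d y < 0 := fun y hy => by
    by_contra! h'
    exact absurd (hmax ⟨⟨hax.trans hy.1.le, hy.2⟩, h'⟩) (not_le.2 hy.1)
  have hmono : MonotoneOn d (Icc x r) := by
    refine monotoneOn_of_deriv_nonneg (convex_Icc x r) (hcI.mono (Icc_subset_Icc_left hax)) ?_ ?_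
    · intro y hy
      rw [interior_Icc] at hy
      exact (hd y (hax.trans_lt hy.1)).differentiableAt.differentiableWithinAt
    · intro y hy
      rw [interior_Icc] at hy
      rw [(hd y (hax.trans_lt hy.1)).deriv]
      exact h y (hax.trans_lt hy.1) (hlt y ⟨hy.1, hy.2.le⟩)
  have := hmono (left_mem_Icc.2 hxr) (right_mem_Icc.2 hxr) hxr
  linarith

/-- Global existence for a scalar ODE on `[0, ∞)` with a globally Lipschitz right-hand side of at
most linear growth in time. -/
theorem exists_solution_Ici {v : ℝ → ℝ → ℝ} {K : NNReal} {B : ℝ} (hB : 0 ≤ B)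
    (hLip : ∀ t, 0 ≤ t → LipschitzWith K (v t))
    (hcont : ∀ x, ContinuousOn (fun t => v t x) (Ici 0))
    (hbound : ∀ t, 0 ≤ t → ∀ x, |v t x| ≤ B * t) (x₀ : ℝ) :
    ∃ q : ℝ → ℝ, q 0 = x₀ ∧ ∀ t, 0 ≤ t → HasDerivWithinAt q (v t (q t)) (Ici 0) t := by
  have hloc : ∀ N : ℕ, ∃ q : ℝ → ℝ, q 0 = x₀ ∧
      ∀ t ∈ Icc (0 : ℝ) N, HasDerivWithinAt q (v t (q t)) (Icc 0 (N : ℝ)) t := by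
    intro N
    have hN : (0 : ℝ) ≤ N := N.cast_nonneg
    -- The speed on `[0, N]` is at most `B N` for every `x`, so a ball of radius `B N · N` is never
    -- left and a single Picard–Lindelöf step covers the whole interval.
    have hPL : IsPicardLindelof v (tmin := 0) (tmax := N) ⟨0, left_mem_Icc.2 hN⟩ x₀
        ⟨B * N * N, by positivity⟩ 0 ⟨B * N, by positivity⟩ K := by
      refine ⟨fun t ht => (hLip t ht.1).lipschitzOnWith, fun x _ =>
        (hcont x).mono Icc_subset_Ici_self, fun t ht x _ => ?_, ?_⟩
      · exact (hbound t ht.1 x).trans (mul_le_mul_of_nonneg_left ht.2 hB)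
      · simp only [sub_zero, sub_self, max_eq_left hN, NNReal.coe_zero]
        exact le_rfl
    exact hPL.exists_eq_forall_mem_Icc_hasDerivWithinAt₀
  choose Q hQ0 hQ using hloc
  have huniq : ∀ (M N : ℕ) (x : ℝ), 0 ≤ x → x ≤ M → x ≤ N → Q M x = Q N x := by
    intro M N x hx hM hN
    have key : ∀ L : ℕ, x ≤ L → ContinuousOn (Q L) (Icc 0 x) ∧
        ∀ t ∈ Ico (0 : ℝ) x, HasDerivWithinAt (Q L) (v t (Q L t)) (Ici t) t := by
      intro L hL
      refine ⟨fun t ht => ((hQ L t ⟨ht.1, ht.2.trans hL⟩).continuousWithinAt).mono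
        (Icc_subset_Icc_right hL), fun t ht => ?_⟩
      refine (hQ L t ⟨ht.1, ht.2.le.trans hL⟩).mono_of_mem_nhdsWithin ?_
      exact mem_of_superset (Icc_mem_nhdsGE (ht.2.trans_le hL)) (Icc_subset_Icc_left ht.1)
    exact ODE_solution_unique_of_mem_Icc_right (s := fun _ => univ) (K := K)
      (fun t ht => (hLip t ht.1).lipschitzOnWith) (key M hM).1 (key M hM).2 (fun _ _ => trivial)
      (key N hN).1 (key N hN).2 (fun _ _ => trivial) (by rw [hQ0, hQ0]) ⟨hx, le_rfl⟩
  -- The `+ 1` keeps `t` strictly below the right endpoint, so that one local solution covers a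
  -- neighbourhood of `t` in the half line.
  have hceil : ∀ x : ℝ, x ≤ (⌈x⌉₊ + 1 : ℕ) := fun x => by
    push_cast
    linarith [Nat.le_ceil x]
  refine ⟨fun x => Q (⌈x⌉₊ + 1) x, hQ0 _, fun t ht => ?_⟩
  have hder := hQ (⌈t⌉₊ + 1) t ⟨ht, hceil t⟩
  have hlt : t < (⌈t⌉₊ + 1 : ℕ) := by
    push_cast
    linarith [Nat.le_ceil t]
  have hmem : Icc (0 : ℝ) (⌈t⌉₊ + 1 : ℕ) ∈ 𝓝[Ici 0] t := by
    rw [← Ici_inter_Iic]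
    exact inter_mem self_mem_nhdsWithin (mem_nhdsWithin_of_mem_nhds (Iic_mem_nhds hlt))
  refine (hder.mono_of_mem_nhdsWithin hmem).congr_of_eventuallyEq ?_ rfl
  filter_upwards [hmem] with x hx
  exact huniq _ _ x hx.1 (hceil x) hx.2

/-! ### Regularity of averages on a closed half line. -/

/-- A function that is `Cⁿ` on the closed half line extends to a `Cⁿ` function on the line. -/
theorem exists_contDiff_extension (n : ℕ) {h : ℝ → ℝ} (hh : ContDiffOn ℝ n h (Ici 0)) :
    ∃ g : ℝ → ℝ, ContDiff ℝ n g ∧ EqOn g h (Ici 0) := by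
  induction n generalizing h with
  | zero =>
    refine ⟨fun t => h (max t 0), ?_, fun t ht => by simp [max_eq_left (mem_Ici.1 ht)]⟩
    rw [Nat.cast_zero, contDiff_zero]
    exact hh.continuousOn.comp_continuous (by fun_prop) (fun t => le_max_right t 0)
  | succ n ih =>
    rw [Nat.cast_succ, contDiffOn_succ_iff_derivWithin (uniqueDiffOn_Ici 0)] at hh
    obtain ⟨hdiff, -, hderiv⟩ := hh
    obtain ⟨G, hG, hGe⟩ := ih hderiv
    -- Integrating an extension of the derivative gains one order and agrees with `h` on the half
    -- line.
    have hg : ∀ t, HasDerivAt (fun t => h 0 + ∫ x in (0 : ℝ)..t, G x) (G t) t := fun t =>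
      (intervalIntegral.integral_hasDerivAt_right (hG.continuous.intervalIntegrable _ _)
        hG.continuous.aestronglyMeasurable.stronglyMeasurableAtFilter
        hG.continuous.continuousAt).const_add _
    refine ⟨fun t => h 0 + ∫ x in (0 : ℝ)..t, G x, ?_, fun t ht => ?_⟩
    · rw [Nat.cast_succ, contDiff_succ_iff_deriv]
      refine ⟨fun t => (hg t).differentiableAt, by simp, ?_⟩
      rwa [show deriv (fun t => h 0 + ∫ x in (0 : ℝ)..t, G x) = G from
        funext fun t => (hg t).deriv]
    · have ht' : (0 : ℝ) ≤ t := ht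
      have := intervalIntegral.integral_eq_sub_of_hasDeriv_right_of_le (f := h) (f' := G) ht'
        (hdiff.continuousOn.mono Icc_subset_Ici_self) (fun x hx => ?_)
        (hG.continuous.intervalIntegrable _ _)
      · simp only [this]
        ring
      · have h1 := (hdiff x hx.1.le).hasDerivWithinAt
        rw [← hGe (show x ∈ Ici (0 : ℝ) from hx.1.le)] at h1
        exact h1.mono fun y hy => (hx.1.trans hy).le

theorem hasDerivAt_integral_pow_mul_comp_mul (m : ℕ) {h h' : ℝ → ℝ}
    (hh : ∀ x, HasDerivAt h (h' x) x) (hc : Continuous h') (t : ℝ) :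
    HasDerivAt (fun t => ∫ τ in (0 : ℝ)..1, τ ^ m * h (t * τ))
      (∫ τ in (0 : ℝ)..1, τ ^ (m + 1) * h' (t * τ)) t := by
  have hcont : Continuous h := continuous_iff_continuousAt.2 fun x => (hh x).continuousAt
  obtain ⟨C, hC⟩ := (isCompact_Icc (a := -(|t| + 1)) (b := |t| + 1)).exists_bound_of_continuousOn
    hc.continuousOn
  refine (intervalIntegral.hasDerivAt_integral_of_dominated_loc_of_deriv_le (bound := fun _ => C)
    (F := fun t τ => τ ^ m * h (t * τ)) (F' := fun t τ => τ ^ (m + 1) * h' (t * τ))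
    (Metric.ball_mem_nhds t one_pos) ?_ ?_ ?_ ?_ ?_ ?_).2
  · exact Eventually.of_forall fun x => (by fun_prop : Continuous _).aestronglyMeasurable
  · exact (by fun_prop : Continuous _).intervalIntegrable _ _
  · exact (by fun_prop : Continuous _).aestronglyMeasurable
  · refine Eventually.of_forall fun τ hτ x hx => ?_
    rw [uIoc_of_le zero_le_one] at hτ
    rw [norm_mul, norm_pow, Real.norm_of_nonneg hτ.1.le]
    have hx1 : |x| ≤ |t| + 1 := by
      have := abs_sub_abs_le_abs_sub x t
      rw [Metric.mem_ball, Real.dist_eq] at hx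
      linarith
    have h1 : ‖h' (x * τ)‖ ≤ C := by
      refine hC _ (abs_le.1 ?_)
      rw [abs_mul, abs_of_pos hτ.1]
      nlinarith [abs_nonneg x, hτ.2, hτ.1]
    have h2 : τ ^ (m + 1) ≤ 1 := pow_le_one₀ hτ.1.le hτ.2
    nlinarith [norm_nonneg (h' (x * τ)), pow_nonneg hτ.1.le (m + 1)]
  · exact intervalIntegrable_const
  · refine Eventually.of_forall fun τ _ x _ => ?_
    have h1 : HasDerivAt (fun x => x * τ) τ x := by simpa using (hasDerivAt_id x).mul_const τ
    have := ((hh (x * τ)).comp x h1).const_mul (τ ^ m)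
    exact this.congr_deriv (by ring)

/-- The weight `τ ^ m` is there for the induction: each derivative in `t` brings out one more factor
`τ`. -/
theorem contDiff_integral_pow_mul_comp_mul (n m : ℕ) {h : ℝ → ℝ} (hh : ContDiff ℝ n h) :
    ContDiff ℝ n (fun t => ∫ τ in (0 : ℝ)..1, τ ^ m * h (t * τ)) := by
  induction n generalizing m h with
  | zero =>
    rw [Nat.cast_zero, contDiff_zero] at *
    exact intervalIntegral.continuous_parametric_intervalIntegral_of_continuous' (by fun_prop) 0 1
  | succ n ih =>
    rw [Nat.cast_succ, contDiff_succ_iff_deriv] at *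
    have hder := hasDerivAt_integral_pow_mul_comp_mul m (fun x => (hh.1 x).hasDerivAt)
      hh.2.2.continuous
    refine ⟨fun t => (hder t).differentiableAt, by simp, ?_⟩
    rw [funext fun t => (hder t).deriv]
    exact ih (m + 1) hh.2.2

/-- The averages `∫₀¹ h (t τ) dτ` of a function that is `Cⁿ` on the closed half line are `Cⁿ`. -/
theorem contDiffOn_integral_comp_mul (n : ℕ) {h : ℝ → ℝ} (hh : ContDiffOn ℝ n h (Ici 0)) :
    ContDiffOn ℝ n (fun t => ∫ τ in (0 : ℝ)..1, h (t * τ)) (Ici 0) := by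
  obtain ⟨g, hg, hge⟩ := exists_contDiff_extension n hh
  refine (contDiff_integral_pow_mul_comp_mul n 0 hg).contDiffOn.congr fun t ht => ?_
  refine intervalIntegral.integral_congr fun τ hτ => ?_
  rw [uIcc_of_le zero_le_one] at hτ
  simp only [pow_zero, one_mul]
  exact (hge (mul_nonneg (mem_Ici.1 ht) hτ.1)).symm

/-! ### The clipped radial equation and its smooth profile. -/

/-- The forcing term `c √(1 - s²) - c₀` with `s` truncated to `[0, k]`. -/
noncomputable def clipForcing (k c₀ c s : ℝ) : ℝ :=
  c * Real.sqrt (1 - (max 0 (min s k)) ^ 2) - c₀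

theorem clipForcing_eq {k c₀ c s : ℝ} (hs : s ∈ Icc 0 k) :
    clipForcing k c₀ c s = c * Real.sqrt (1 - s ^ 2) - c₀ := by
  rw [clipForcing, min_eq_left hs.2, max_eq_right hs.1]

/-- Multiply by the conjugate: the two roots add up to at least `2 σ`, while `|a + b| ≤ 2`. -/
theorem abs_sqrt_sub_sqrt_le {σ a b : ℝ} (hσ : 0 < σ) (ha : a ^ 2 ≤ 1 - σ ^ 2)
    (hb : b ^ 2 ≤ 1 - σ ^ 2) :
    |Real.sqrt (1 - a ^ 2) - Real.sqrt (1 - b ^ 2)| ≤ |a - b| / σ := by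
  have hX : σ ≤ Real.sqrt (1 - a ^ 2) := Real.le_sqrt_of_sq_le (by linarith)
  have hY : σ ≤ Real.sqrt (1 - b ^ 2) := Real.le_sqrt_of_sq_le (by linarith)
  have hX2 : Real.sqrt (1 - a ^ 2) ^ 2 = 1 - a ^ 2 := Real.sq_sqrt (by nlinarith)
  have hY2 : Real.sqrt (1 - b ^ 2) ^ 2 = 1 - b ^ 2 := Real.sq_sqrt (by nlinarith)
  set X := Real.sqrt (1 - a ^ 2)
  set Y := Real.sqrt (1 - b ^ 2)
  have hprod : |X - Y| * (X + Y) = |a - b| * |a + b| := by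
    rw [← abs_of_nonneg (by linarith : 0 ≤ X + Y), ← abs_mul, ← abs_mul, ← abs_neg]
    congr 1
    linear_combination hY2 - hX2
  have hab : |a + b| ≤ 2 := abs_le_of_sq_le_sq (by nlinarith [sq_nonneg (a - b)]) zero_le_two
  rw [le_div_iff₀ hσ]
  nlinarith [abs_nonneg (X - Y), abs_nonneg (a - b)]

/-- Admissible parameters: `(k, σ) = (cos α, sin α)` with `α ∈ (0, π / 2]` and `c = c₀ / σ`. -/
structure Params (k σ c₀ c : ℝ) : Prop where
  k_nonneg : 0 ≤ k
  σ_pos : 0 < σ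
  sq_add_sq : σ ^ 2 + k ^ 2 = 1
  c₀_pos : 0 < c₀
  c_mul : c * σ = c₀

namespace Params

variable {k σ c₀ c : ℝ}

theorem c_pos (h : Params k σ c₀ c) : 0 < c := by
  have h1 := h.c₀_pos
  rw [← h.c_mul] at h1
  exact pos_of_mul_pos_left h1 h.σ_pos.le

theorem k_lt_one (h : Params k σ c₀ c) : k < 1 := by
  nlinarith [h.σ_pos, h.sq_add_sq, h.k_nonneg]

theorem le_sqrt (h : Params k σ c₀ c) {y : ℝ} (hy : y ≤ k ^ 2) : σ ≤ Real.sqrt (1 - y) := by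
  apply Real.le_sqrt_of_sq_le
  linarith [h.sq_add_sq]

theorem sqrt_k (h : Params k σ c₀ c) : Real.sqrt (1 - k ^ 2) = σ := by
  rw [← h.sq_add_sq, add_sub_cancel_right, Real.sqrt_sq h.σ_pos.le]

theorem clip_mem (h : Params k σ c₀ c) (s : ℝ) : max 0 (min s k) ∈ Icc 0 k :=
  ⟨le_max_left _ _, max_le h.k_nonneg (min_le_right _ _)⟩

theorem clip_sq_le (h : Params k σ c₀ c) (s : ℝ) : (max 0 (min s k)) ^ 2 ≤ k ^ 2 :=
  pow_le_pow_left₀ (h.clip_mem s).1 (h.clip_mem s).2 2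

theorem clipForcing_nonneg (h : Params k σ c₀ c) (s : ℝ) : 0 ≤ clipForcing k c₀ c s := by
  have := mul_le_mul_of_nonneg_left (h.le_sqrt (h.clip_sq_le s)) h.c_pos.le
  rw [h.c_mul] at this
  exact sub_nonneg.2 this

theorem clipForcing_le (h : Params k σ c₀ c) (s : ℝ) : clipForcing k c₀ c s ≤ c := by
  have h1 : Real.sqrt (1 - (max 0 (min s k)) ^ 2) ≤ 1 := by
    rw [Real.sqrt_le_left zero_le_one]
    nlinarith [sq_nonneg (max 0 (min s k))]
  have := mul_le_mul_of_nonneg_left h1 h.c_pos.le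
  unfold clipForcing
  linarith [h.c₀_pos]

theorem clipForcing_of_le (h : Params k σ c₀ c) {s : ℝ} (hs : k ≤ s) :
    clipForcing k c₀ c s = 0 := by
  rw [clipForcing, min_eq_right hs, max_eq_right h.k_nonneg, h.sqrt_k, h.c_mul, sub_self]

theorem lipschitzWith_clipForcing (h : Params k σ c₀ c) :
    LipschitzWith (Real.toNNReal (c / σ)) (clipForcing k c₀ c) := by
  refine LipschitzWith.of_dist_le_mul fun x y => ?_
  rw [Real.coe_toNNReal _ (div_nonneg h.c_pos.le h.σ_pos.le), Real.dist_eq, Real.dist_eq]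
  set a := max 0 (min x k) with ha
  set b := max 0 (min y k) with hb
  have hab : |a - b| ≤ |x - y| := by
    rw [ha, hb]
    exact (abs_max_sub_max_le_abs _ _ 0 |>.trans' (by rw [max_comm 0, max_comm 0])).trans
      ((abs_min_sub_min_le_max x k y k).trans (by simp))
  have e1 : clipForcing k c₀ c x - clipForcing k c₀ c y
      = c * (Real.sqrt (1 - a ^ 2) - Real.sqrt (1 - b ^ 2)) := by
    simp only [clipForcing, ← ha, ← hb]
    ring
  have h3 : |Real.sqrt (1 - a ^ 2) - Real.sqrt (1 - b ^ 2)| ≤ |x - y| / σ := by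
    refine (abs_sqrt_sub_sqrt_le h.σ_pos ?_ ?_).trans (div_le_div_of_nonneg_right hab h.σ_pos.le)
    · linarith [h.clip_sq_le x, h.sq_add_sq]
    · linarith [h.clip_sq_le y, h.sq_add_sq]
  rw [e1, abs_mul, abs_of_pos h.c_pos]
  calc c * |Real.sqrt (1 - a ^ 2) - Real.sqrt (1 - b ^ 2)| ≤ c * (|x - y| / σ) :=
      mul_le_mul_of_nonneg_left h3 h.c_pos.le
    _ = c / σ * |x - y| := by ring

/-- The factor `r` cancels the `1 / r` in the argument, so the Lipschitz constant `c / σ` in the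
flux is uniform down to `r = 0`. -/
theorem exists_clip_solution (h : Params k σ c₀ c) :
    ∃ q : ℝ → ℝ, q 0 = 0 ∧
      ∀ r, 0 ≤ r → HasDerivWithinAt q (r * clipForcing k c₀ c (q r / r)) (Ici 0) r := by
  refine exists_solution_Ici (v := fun r x => r * clipForcing k c₀ c (x / r))
    (K := Real.toNNReal (c / σ)) h.c_pos.le (fun r hr => ?_) (fun x => ?_) (fun r hr x => ?_) 0
  · rcases hr.eq_or_lt with rfl | hr
    · simpa using (LipschitzWith.const (0 : ℝ)).weaken (zero_le)
    · refine LipschitzWith.of_dist_le_mul fun x y => ?_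
      have := h.lipschitzWith_clipForcing.dist_le_mul (x / r) (y / r)
      rw [Real.dist_eq, Real.dist_eq] at *
      rw [← mul_sub, abs_mul, abs_of_pos hr]
      rw [← sub_div, abs_div, abs_of_pos hr] at this
      calc _ ≤ r * _ := mul_le_mul_of_nonneg_left this hr.le
        _ = _ := by field_simp
  · intro r hr
    rcases (mem_Ici.1 hr).eq_or_lt with rfl | hr
    · have : Tendsto (fun r : ℝ => r * clipForcing k c₀ c (x / r)) (𝓝 0) (𝓝 0) := by
        refine squeeze_zero_norm (a := fun r => |r| * c) (fun r => ?_) ?_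
        · rw [norm_mul, Real.norm_of_nonneg (h.clipForcing_nonneg _), Real.norm_eq_abs]
          exact mul_le_mul_of_nonneg_left (h.clipForcing_le _) (abs_nonneg r)
        · exact (by fun_prop : Continuous fun r : ℝ => |r| * c).tendsto' 0 0 (by simp)
      have h2 : ContinuousAt (fun r : ℝ => r * clipForcing k c₀ c (x / r)) 0 := by
        rw [ContinuousAt, zero_mul]
        exact this
      exact h2.continuousWithinAt
    · exact (continuousAt_id.mul (h.lipschitzWith_clipForcing.continuous.continuousAt.comp
        (continuousAt_const.div continuousAt_id hr.ne'))).continuousWithinAt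
  · rw [abs_mul, abs_of_nonneg hr, abs_of_nonneg (h.clipForcing_nonneg _), mul_comm]
    exact mul_le_mul_of_nonneg_right (h.clipForcing_le _) hr

/-- The regular radial solution, in the form `s(r) = r p(r²)` for the sine `s` of the angle of
the graph, with `p` smooth up to `0`. -/
theorem exists_profile (h : Params k σ c₀ c) :
    ∃ p : ℝ → ℝ, ContDiffOn ℝ ∞ p (Ici 0) ∧ (∀ t, 0 ≤ t → 0 ≤ p t) ∧
      (∀ t, 0 ≤ t → t * p t ^ 2 ≤ k ^ 2) ∧
      ∀ t, 0 ≤ t →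
        2 * p t + 2 * t * derivWithin p (Ici 0) t = c * Real.sqrt (1 - t * p t ^ 2) - c₀ := by
  obtain ⟨q, hq0, hq⟩ := h.exists_clip_solution
  have hqc : ContinuousOn q (Ici 0) := fun r hr => (hq r hr).continuousWithinAt
  have hqd : ∀ r, 0 < r → HasDerivAt q (r * clipForcing k c₀ c (q r / r)) r := fun r hr =>
    (hq r hr.le).hasDerivAt (Ici_mem_nhds hr)
  have hq_nonneg : ∀ r, 0 ≤ r → 0 ≤ q r := fun r hr =>
    nonneg_of_deriv_nonneg_of_neg hqc hqd hq0.ge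
      (fun r hr _ => mul_nonneg hr.le (h.clipForcing_nonneg _)) hr
  -- Where `q` exceeds `r k`, the clipped forcing is zero, so `q` cannot cross this barrier.
  have hq_le : ∀ r, 0 ≤ r → q r ≤ r * k := by
    intro r hr
    have := nonneg_of_deriv_nonneg_of_neg (d := fun r => r * k - q r)
      (d' := fun r => 1 * k - r * clipForcing k c₀ c (q r / r)) (by fun_prop)
      (fun r hr => ((hasDerivAt_id r).mul_const k).sub (hqd r hr)) (by simp [hq0])
      (fun r hr hneg => by
        rw [h.clipForcing_of_le ((le_div_iff₀ hr).2 (by linarith))]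
        simpa using h.k_nonneg) hr
    simpa using this
  -- This quadratic bound makes `q r / r` continuous at the origin, where division by zero gives the
  -- right value `0`.
  have hq_sq : ∀ r, 0 ≤ r → q r ≤ c * r ^ 2 := by
    intro r hr
    have := nonneg_of_deriv_nonneg_of_neg (d := fun r => c * r ^ 2 - q r)
      (d' := fun r => c * (2 * r) - r * clipForcing k c₀ c (q r / r)) (by fun_prop)
      (fun r hr => by
        exact (((hasDerivAt_pow 2 r).const_mul c).sub (hqd r hr)).congr_deriv (by simp)) (by simp [hq0])
      (fun r hr _ => by nlinarith [h.clipForcing_le (q r / r), h.c_pos]) hr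
    simpa using this
  set s : ℝ → ℝ := fun r => q r / r with hs
  have hs_mem : ∀ r, 0 ≤ r → s r ∈ Icc 0 k := fun r hr =>
    ⟨div_nonneg (hq_nonneg r hr) hr, div_le_of_le_mul₀ hr h.k_nonneg (by linarith [hq_le r hr])⟩
  have hsc : ContinuousOn s (Ici 0) := by
    intro r hr
    rcases (mem_Ici.1 hr).eq_or_lt with rfl | hr
    · have h0 : s 0 = 0 := by simp [hs]
      rw [ContinuousWithinAt, h0]
      refine squeeze_zero' (g := fun r => c * r) ?_ ?_ ?_
      · filter_upwards [self_mem_nhdsWithin] with r hr using (hs_mem r hr).1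
      · filter_upwards [self_mem_nhdsWithin] with r hr
        refine div_le_of_le_mul₀ hr (mul_nonneg h.c_pos.le hr) ?_
        linarith [hq_sq r hr]
      · exact ((by fun_prop : Continuous fun r : ℝ => c * r).tendsto' 0 0 (by simp)).mono_left
          nhdsWithin_le_nhds
    · exact ((hqd r hr).continuousAt.div continuousAt_id hr.ne').continuousWithinAt
  -- In the variable `t = r²` the flux has derivative `hF`; the `1 / 2` is `r dr / dt`. Averaging
  -- `hF` over `[0, t]` gives `p` with no division at `0`.
  set hF : ℝ → ℝ := fun t => clipForcing k c₀ c (s (Real.sqrt t)) / 2 with hhF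
  have hFc : Continuous hF :=
    (h.lipschitzWith_clipForcing.continuous.comp
      (hsc.comp_continuous Real.continuous_sqrt Real.sqrt_nonneg)).div_const 2
  set p : ℝ → ℝ := fun t => ∫ τ in (0 : ℝ)..1, hF (t * τ) with hp
  have hpc : Continuous p :=
    intervalIntegral.continuous_parametric_intervalIntegral_of_continuous' (by fun_prop) 0 1
  have htp : ∀ t, t * p t = ∫ x in (0 : ℝ)..t, hF x := by
    intro t
    have := intervalIntegral.mul_integral_comp_mul_left (f := hF) (a := 0) (b := 1) t
    simpa only [smul_eq_mul, mul_zero, mul_one] using this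
  have htpd : ∀ t, HasDerivAt (fun t => t * p t) (hF t) t := by
    intro t
    rw [funext htp]
    exact intervalIntegral.integral_hasDerivAt_right (hFc.intervalIntegrable _ _)
        hFc.aestronglyMeasurable.stronglyMeasurableAtFilter hFc.continuousAt
  have htq : ∀ t, 0 ≤ t → t * p t = q (Real.sqrt t) := by
    intro t ht
    rw [htp, intervalIntegral.integral_eq_sub_of_hasDerivAt_of_le ht
      (f := fun t => q (Real.sqrt t)) ?_ ?_ (hFc.intervalIntegrable _ _)]
    · simp [hq0]
    · exact (hqc.comp_continuous Real.continuous_sqrt Real.sqrt_nonneg).continuousOn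
    · intro x hx
      have h1 := (hqd (Real.sqrt x) (Real.sqrt_pos.2 hx.1)).comp x (Real.hasDerivAt_sqrt hx.1.ne')
      refine h1.congr_deriv ?_
      have := (Real.sqrt_pos.2 hx.1).ne'
      simp only [hhF, hs]
      field_simp
  have hsp : ∀ t, 0 ≤ t → s (Real.sqrt t) = Real.sqrt t * p t := by
    intro t ht
    rcases ht.eq_or_lt with rfl | ht
    · simp [hs]
    · have := (Real.sqrt_pos.2 ht).ne'
      simp only [hs]
      rw [← htq t ht.le, div_eq_iff this]
      nth_rewrite 1 [← Real.mul_self_sqrt ht.le]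
      ring
  have hs2 : ∀ t, 0 ≤ t → t * p t ^ 2 = s (Real.sqrt t) ^ 2 := by
    intro t ht
    rw [hsp t ht, mul_pow, Real.sq_sqrt ht]
  have hp_nonneg : ∀ t, 0 ≤ p t := fun t =>
    intervalIntegral.integral_nonneg zero_le_one fun τ _ =>
      div_nonneg (h.clipForcing_nonneg _) zero_le_two
  have hp_le : ∀ t, 0 ≤ t → t * p t ^ 2 ≤ k ^ 2 := fun t ht => by
    rw [hs2 t ht]
    exact pow_le_pow_left₀ (hs_mem _ (Real.sqrt_nonneg t)).1 (hs_mem _ (Real.sqrt_nonneg t)).2 2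
  have hFe : ∀ t, 0 ≤ t → hF t = (c * Real.sqrt (1 - t * p t ^ 2) - c₀) / 2 := fun t ht => by
    simp only [hhF]
    rw [clipForcing_eq (hs_mem _ (Real.sqrt_nonneg t)), hs2 t ht]
  have hp0 : p 0 = hF 0 := by simp [hp]
  -- The bootstrap: as `t p² = (t p)² / t` and `(t p)' = hF`, this derivative contains no `p'`. Thus
  -- `t p²`, with it `hF`, and then the average `p`, have one order more than was known of `p`.
  have hyd : ∀ t ∈ Ici (0 : ℝ), HasDerivWithinAt (fun t => t * p t ^ 2)
      (2 * p t * hF t - p t ^ 2) (Ici 0) t := by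
    intro t ht
    rcases (mem_Ici.1 ht).eq_or_lt with rfl | ht
    · rw [← hp0, hasDerivWithinAt_iff_tendsto_slope]
      have h1 : Tendsto (fun t => p t ^ 2) (𝓝[Ici 0 \ {0}] 0) (𝓝 (p 0 ^ 2)) :=
        ((hpc.pow 2).tendsto 0).mono_left nhdsWithin_le_nhds
      rw [show 2 * p 0 * p 0 - p 0 ^ 2 = p 0 ^ 2 by ring]
      refine h1.congr' ?_
      filter_upwards [self_mem_nhdsWithin] with t ht
      have : t ≠ 0 := ht.2
      rw [slope_def_field]
      field_simp
      ring
    · have h1 := (((htpd t).pow 2).div (hasDerivAt_id t) ht.ne').hasDerivWithinAt (s := Ici 0)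
      refine (h1.congr_of_mem (fun x hx => ?_) ht.le).congr_deriv ?_
      · rcases eq_or_ne x 0 with rfl | hx
        · simp
        · simp only [Pi.div_apply, Pi.pow_apply, id]
          field_simp
      · simp only [id, Pi.pow_apply, Nat.cast_ofNat]
        field_simp
        ring
  have hsmooth : ∀ n : ℕ, ContDiffOn ℝ n p (Ici 0) := by
    intro n
    induction n with
    | zero =>
      rw [Nat.cast_zero, contDiffOn_zero]
      exact hpc.continuousOn
    | succ n ih =>
      have hFreg : ∀ m : ℕ, ContDiffOn ℝ m (fun t => t * p t ^ 2) (Ici 0) →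
          ContDiffOn ℝ m hF (Ici 0) := by
        intro m hm
        refine ContDiffOn.congr (f := fun t => (c * Real.sqrt (1 - t * p t ^ 2) - c₀) / 2) ?_
          fun t ht => hFe t ht
        refine (((contDiffOn_const.mul ((contDiffOn_const.sub hm).sqrt fun t ht => ?_)).sub
          contDiffOn_const).div_const 2)
        have := hp_le t ht
        nlinarith [h.σ_pos, h.sq_add_sq]
      refine contDiffOn_integral_comp_mul (n + 1) (hFreg (n + 1) ?_)
      rw [Nat.cast_succ, contDiffOn_succ_iff_derivWithin (uniqueDiffOn_Ici 0)]
      refine ⟨fun t ht => (hyd t ht).differentiableWithinAt, by simp, ?_⟩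
      refine ContDiffOn.congr ?_ fun t ht => (hyd t ht).derivWithin (uniqueDiffOn_Ici 0 t ht)
      exact ((contDiffOn_const.mul ih).mul
        (hFreg n (contDiffOn_id.mul (ih.pow 2)))).sub (ih.pow 2)
  refine ⟨p, contDiffOn_infty.2 hsmooth, fun t _ => hp_nonneg t, hp_le, fun t ht => ?_⟩
  have hd : DifferentiableWithinAt ℝ p (Ici 0) t :=
    (hsmooth 1).differentiableOn (by norm_num) t ht
  have h1 := (hasDerivWithinAt_id t (Ici 0)).mul hd.hasDerivWithinAt
  have h2 := (uniqueDiffOn_Ici 0 t ht).eq_deriv _ h1 (htpd t).hasDerivWithinAt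
  rw [hFe t ht] at h2
  simp only [id] at h2
  linarith

end Params

/-! ### Gradient and divergence of radial fields. -/

theorem divergence_smul_self {a : E → ℝ} {a' : E →L[ℝ] ℝ} {x : E} (ha : HasFDerivAt a a' x) :
    divergence (fun y => a y • y) x = 2 * a x + a' x := by
  have h := ha.smul (hasFDerivAt_id x)
  have hx : x = x 0 • EuclideanSpace.single 0 (1 : ℝ) + x 1 • EuclideanSpace.single 1 (1 : ℝ) := by
    ext i
    fin_cases i <;> simp
  have h2 : a' x = x 0 * a' (EuclideanSpace.single 0 1) + x 1 * a' (EuclideanSpace.single 1 1) := by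
    conv_lhs => rw [hx]
    simp
  have h3 : fderiv ℝ (fun y => a y • y) x = _ := h.fderiv
  rw [divergence, h3, h2]
  simp [Fin.sum_univ_two]
  ring

/-- Since `‖y‖²` is never negative, a one-sided derivative of `g` suffices; this is what includes
the origin. -/
theorem hasFDerivAt_comp_norm_sq {g : ℝ → ℝ} {g' : ℝ} {x : E}
    (hg : HasDerivWithinAt g g' (Ici 0) (‖x‖ ^ 2)) :
    HasFDerivAt (fun y : E => g (‖y‖ ^ 2)) ((2 * g') • innerSL ℝ x) x := by
  have h1 : HasFDerivAt (fun y : E => ‖y‖ ^ 2) (2 • innerSL ℝ x) x :=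
    (hasStrictFDerivAt_norm_sq x).hasFDerivAt
  have h2 := hg.comp_hasFDerivWithinAt (s := univ) x h1.hasFDerivWithinAt
    (fun y _ => sq_nonneg ‖y‖)
  rw [hasFDerivWithinAt_univ] at h2
  refine h2.congr_fderiv ?_
  ext y
  simp
  ring

theorem gradient_comp_norm_sq {g : ℝ → ℝ} {g' : ℝ} {x : E}
    (hg : HasDerivWithinAt g g' (Ici 0) (‖x‖ ^ 2)) :
    gradient (fun y : E => g (‖y‖ ^ 2)) x = (2 * g') • x := by
  apply HasGradientAt.gradient
  rw [hasGradientAt_iff_hasFDerivAt]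
  refine (hasFDerivAt_comp_norm_sq hg).congr_fderiv ?_
  ext y
  simp

theorem divergence_comp_norm_sq_smul {A : ℝ → ℝ} {A' : ℝ} {x : E}
    (hA : HasDerivWithinAt A A' (Ici 0) (‖x‖ ^ 2)) :
    divergence (fun y : E => A (‖y‖ ^ 2) • y) x = 2 * A (‖x‖ ^ 2) + 2 * ‖x‖ ^ 2 * A' := by
  rw [divergence_smul_self (hasFDerivAt_comp_norm_sq hA)]
  simp
  ring

/-! ### Reduction to the flux equation, and uniqueness. -/

/-- A `C²` radial solution away from the origin solves the radial ODE, written for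
`q = - r f' / √(1 + f'²)`. -/
theorem IsSolutionOn.exists_flux {c₀ c : ℝ} {φ : E → ℝ} (hφ : IsSolutionOn c₀ c φ {0}ᶜ)
    {f : ℝ → ℝ} (hf : ∀ x, φ x = f ‖x‖) :
    ∃ q : ℝ → ℝ, ∀ r, 0 < r → |q r| < r ∧
      HasDerivAt q (r * (c * Real.sqrt (1 - (q r / r) ^ 2) - c₀)) r ∧
      HasDerivAt f (-(q r / r) / Real.sqrt (1 - (q r / r) ^ 2)) r := by
  obtain ⟨hreg, heq⟩ := hφ
  set e : E := EuclideanSpace.single 0 1 with he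
  have hne : ∀ r, 0 < r → ‖r • e‖ = r := fun r hr => by
    rw [norm_smul, he]
    simp [abs_of_pos hr]
  have hfreg : ContDiffOn ℝ 2 f (Ioi 0) := by
    have h1 : ContDiffOn ℝ 2 (fun r : ℝ => φ (r • e)) (Ioi 0) :=
      hreg.comp (by fun_prop) fun r hr => by
        have := hne r hr
        intro h0
        rw [mem_singleton_iff.1 h0, norm_zero] at this
        exact (mem_Ioi.1 hr).ne this
    exact h1.congr fun r hr => by rw [hf, hne r hr]
  rw [show (2 : ℕ∞ω) = 1 + 1 by norm_num, contDiffOn_succ_iff_deriv_of_isOpen isOpen_Ioi] at hfreg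
  obtain ⟨hfd, -, hud⟩ := hfreg
  have hu : ∀ r, 0 < r → HasDerivAt f (deriv f r) r := fun r hr =>
    (hfd.differentiableAt (Ioi_mem_nhds hr)).hasDerivAt
  have hu' : ∀ r, 0 < r → DifferentiableAt ℝ (deriv f) r := fun r hr =>
    (hud.differentiableOn (by norm_num)).differentiableAt (Ioi_mem_nhds hr)
  set u := deriv f with hudef
  set q : ℝ → ℝ := fun r => -(r * u r) / Real.sqrt (1 + u r ^ 2) with hq
  have hpos : ∀ r, 0 < 1 + u r ^ 2 := fun r => by positivity
  have hqr : ∀ r, 0 < r → q r / r = -u r / Real.sqrt (1 + u r ^ 2) := fun r hr => by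
    simp only [hq]
    field_simp
  have hsq : ∀ r, 0 < r → Real.sqrt (1 - (q r / r) ^ 2) = 1 / Real.sqrt (1 + u r ^ 2) := by
    intro r hr
    rw [hqr r hr, div_pow, Real.sq_sqrt (hpos r).le, ← Real.sqrt_one, ← Real.sqrt_div zero_le_one,
      Real.sqrt_one]
    congr 1
    have := (hpos r).ne'
    field_simp
    ring
  have hqd : ∀ r, 0 < r → DifferentiableAt ℝ q r := by
    intro r hr
    have := hu' r hr
    exact ((differentiableAt_id.mul this).neg).div ((by fun_prop :
      DifferentiableAt ℝ (fun r => 1 + u r ^ 2) r).sqrt (hpos r).ne')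
      (Real.sqrt_pos.2 (hpos r)).ne'
  have hgrad : ∀ y : E, y ≠ 0 → gradient φ y = (u ‖y‖ / ‖y‖) • y := by
    intro y hy
    have hy0 : 0 < ‖y‖ := norm_pos_iff.2 hy
    have h1 : φ = fun y : E => (f ∘ Real.sqrt) (‖y‖ ^ 2) := by
      ext y
      simp [hf]
    have h2 : HasDerivAt (f ∘ Real.sqrt) (u ‖y‖ * (1 / (2 * ‖y‖))) (‖y‖ ^ 2) := by
      have h3 := Real.hasDerivAt_sqrt (x := ‖y‖ ^ 2) (by positivity)
      have h4 := HasDerivAt.comp (‖y‖ ^ 2) (h₂ := f) (h₂' := u ‖y‖)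
        (by rw [Real.sqrt_sq hy0.le]; exact hu _ hy0) h3
      rwa [Real.sqrt_sq hy0.le] at h4
    rw [h1, gradient_comp_norm_sq h2.hasDerivWithinAt]
    congr 1
    field_simp
  have hgn : ∀ y : E, y ≠ 0 → ‖gradient φ y‖ ^ 2 = u ‖y‖ ^ 2 := by
    intro y hy
    have hy0 : 0 < ‖y‖ := norm_pos_iff.2 hy
    rw [hgrad y hy, norm_smul, mul_pow, Real.norm_eq_abs, sq_abs]
    field_simp
  refine ⟨q, fun r hr => ⟨?_, ?_, ?_⟩⟩
  · have h1 : |q r / r| < 1 := by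
      rw [← sq_lt_one_iff_abs_lt_one, hqr r hr, div_pow, Real.sq_sqrt (hpos r).le,
        div_lt_one (hpos r), neg_sq]
      linarith
    rwa [abs_div, abs_of_pos hr, div_lt_one hr] at h1
  · have hx0 : r • e ≠ 0 := norm_pos_iff.1 (by rwa [hne r hr])
    have hA : HasDerivAt (fun t => -q (Real.sqrt t) / t)
        ((-(deriv q r * (1 / (2 * r))) * r ^ 2 - -q r * 1) / (r ^ 2) ^ 2) (r ^ 2) := by
      have h3 := Real.hasDerivAt_sqrt (x := r ^ 2) (by positivity)
      have h4 := HasDerivAt.comp (r ^ 2) (h₂ := q) (h₂' := deriv q r)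
        (by rw [Real.sqrt_sq hr.le]; exact (hqd _ hr).hasDerivAt) h3
      have h5 := h4.neg.div (hasDerivAt_id (r ^ 2)) (by simp [hr.ne'])
      simp only [Real.sqrt_sq hr.le, Function.comp_apply, id, Pi.neg_apply] at h5
      exact h5
    have hEq : (fun y => (1 / Real.sqrt (1 + ‖gradient φ y‖ ^ 2)) • gradient φ y)
        =ᶠ[𝓝 (r • e)] fun y => (-q (Real.sqrt (‖y‖ ^ 2)) / ‖y‖ ^ 2) • y := by
      filter_upwards [isOpen_compl_singleton.mem_nhds hx0] with y hy
      have hy0 : 0 < ‖y‖ := norm_pos_iff.2 hy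
      rw [hgn y hy, hgrad y hy, smul_smul, Real.sqrt_sq hy0.le]
      congr 1
      simp only [hq]
      field_simp
    have hdiv := divergence_comp_norm_sq_smul (x := r • e)
      (hA.hasDerivWithinAt.congr_deriv rfl |> fun h => by rwa [hne r hr])
    have h0 := heq (r • e) hx0
    rw [mcmOperator, divergence, hEq.fderiv_eq, ← divergence, hdiv, hgn _ hx0, hne r hr,
      Real.sqrt_sq hr.le] at h0
    have h1 : deriv q r = r * (c * Real.sqrt (1 - (q r / r) ^ 2) - c₀) := by
      rw [hsq r hr]
      have : deriv q r / r + c₀ - c / Real.sqrt (1 + u r ^ 2) = 0 := by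
        rw [← h0]
        field_simp
        ring
      field_simp at this ⊢
      linarith
    rw [← h1]
    exact (hqd r hr).hasDerivAt
  · refine (hu r hr).congr_deriv ?_
    rw [hsq r hr, hqr r hr]
    have := (Real.sqrt_pos.2 (hpos r)).ne'
    field_simp

/-- The radial ODE has at most one solution. -/
theorem flux_unique {c₀ c : ℝ} (hc₀ : 0 < c₀) (hc : 0 < c) {q₁ q₂ : ℝ → ℝ}
    (h₁ : ∀ r, 0 < r → |q₁ r| < r ∧
      HasDerivAt q₁ (r * (c * Real.sqrt (1 - (q₁ r / r) ^ 2) - c₀)) r)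
    (h₂ : ∀ r, 0 < r → |q₂ r| < r ∧
      HasDerivAt q₂ (r * (c * Real.sqrt (1 - (q₂ r / r) ^ 2) - c₀)) r) {R : ℝ} (hR : 0 < R) :
    q₁ R = q₂ R := by
  set v : ℝ → ℝ → ℝ := fun r x => r * (c * Real.sqrt (1 - (x / r) ^ 2) - c₀) with hv
  -- From `|q| < r` alone, `q → 0` at the origin; integrating `|q'| ≤ (c + c₀) r` gives `|q| ≤ (c +
  -- c₀) r²`. Hence `|q / r|` is continuous on `[0, R]`, and its maximum `ρ` is below `1`.
  have key : ∀ q : ℝ → ℝ, (∀ r, 0 < r → |q r| < r ∧ HasDerivAt q (v r (q r)) r) →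
      ∃ Q : ℝ → ℝ, Q 0 = 0 ∧ (∀ r, 0 < r → Q r = q r) ∧
        (∀ r, 0 ≤ r → HasDerivWithinAt Q (v r (Q r)) (Ici r) r) ∧ ContinuousOn Q (Ici 0) ∧
        ∃ ρ, 0 ≤ ρ ∧ ρ < 1 ∧ ∀ r ∈ Icc 0 R, |Q r| ≤ ρ * r := by
    intro q hq
    set Q : ℝ → ℝ := fun r => if 0 < r then q r else 0 with hQ
    have hQq : ∀ r, 0 < r → Q r = q r := fun r hr => by simp [hQ, hr]
    have hQ0 : Q 0 = 0 := by simp [hQ]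
    have hQd : ∀ r, 0 < r → HasDerivAt Q (v r (Q r)) r := by
      intro r hr
      rw [hQq r hr]
      refine (hq r hr).2.congr_of_eventuallyEq ?_
      filter_upwards [Ioi_mem_nhds hr] with x hx using hQq x hx
    have hQc : ContinuousOn Q (Ici 0) := by
      intro r hr
      rcases (mem_Ici.1 hr).eq_or_lt with rfl | hr
      · rw [ContinuousWithinAt, hQ0]
        refine squeeze_zero_norm' (a := fun r => r) ?_ (tendsto_id.mono_left nhdsWithin_le_nhds)
        filter_upwards [self_mem_nhdsWithin] with r hr
        rcases (mem_Ici.1 hr).eq_or_lt with rfl | hr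
        · simp [hQ0]
        · rw [hQq r hr]
          exact (hq r hr).1.le
      · exact (hQd r hr).continuousAt.continuousWithinAt
    have hvle : ∀ r, 0 < r → |v r (Q r)| ≤ (c + c₀) * r := by
      intro r hr
      have h1 : Real.sqrt (1 - (Q r / r) ^ 2) ≤ 1 := by
        rw [Real.sqrt_le_left zero_le_one]
        nlinarith [sq_nonneg (Q r / r)]
      have h2 := Real.sqrt_nonneg (1 - (Q r / r) ^ 2)
      simp only [hv]
      rw [abs_mul, abs_of_pos hr, mul_comm]
      refine mul_le_mul_of_nonneg_right (abs_le.2 ⟨?_, ?_⟩) hr.le <;> nlinarith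
    have hQ2 : ∀ r, 0 ≤ r → |Q r| ≤ (c + c₀) * r ^ 2 := by
      intro r hr
      have hpow : ∀ r, HasDerivAt (fun r : ℝ => (c + c₀) * r ^ 2) ((c + c₀) * (2 * r)) r :=
        fun r => ((hasDerivAt_pow 2 r).const_mul (c + c₀)).congr_deriv (by simp)
      have e1 := nonneg_of_deriv_nonneg_of_neg (d := fun r => (c + c₀) * r ^ 2 - Q r)
        (by fun_prop) (fun r hr => (hpow r).sub (hQd r hr)) (by simp [hQ0])
        (fun r hr _ => by nlinarith [(abs_le.1 (hvle r hr)).2]) hr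
      have e2 := nonneg_of_deriv_nonneg_of_neg (d := fun r => (c + c₀) * r ^ 2 + Q r)
        (by fun_prop) (fun r hr => (hpow r).add (hQd r hr)) (by simp [hQ0])
        (fun r hr _ => by nlinarith [(abs_le.1 (hvle r hr)).1]) hr
      exact abs_le.2 ⟨by linarith, by linarith⟩
    have hsc : ContinuousOn (fun r => |Q r / r|) (Icc 0 R) := by
      intro r hr
      rcases hr.1.eq_or_lt with rfl | hr'
      · rw [ContinuousWithinAt, div_zero, abs_zero]
        refine squeeze_zero' (g := fun r => (c + c₀) * r)
          (Eventually.of_forall fun r => abs_nonneg _) ?_ ?_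
        · filter_upwards [self_mem_nhdsWithin] with r hr
          rw [abs_div, abs_of_nonneg hr.1]
          refine div_le_of_le_mul₀ hr.1 (mul_nonneg (by linarith) hr.1) ?_
          linarith [hQ2 r hr.1]
        · exact ((by fun_prop : Continuous fun r : ℝ => (c + c₀) * r).tendsto' 0 0
            (by simp)).mono_left nhdsWithin_le_nhds
      · exact ((hQd r hr').continuousAt.div continuousAt_id hr'.ne').abs.continuousWithinAt
    obtain ⟨r₀, hr₀, hmax⟩ := isCompact_Icc.exists_isMaxOn ⟨0, left_mem_Icc.2 hR.le⟩ hsc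
    refine ⟨Q, hQ0, hQq, fun r hr => ?_, hQc, |Q r₀ / r₀|, abs_nonneg _, ?_, fun r hr => ?_⟩
    · rcases hr.eq_or_lt with rfl | hr
      · rw [hasDerivWithinAt_iff_tendsto_slope, show v 0 (Q 0) = 0 by simp [hv]]
        refine squeeze_zero_norm' (a := fun r => (c + c₀) * r) ?_
          (((by fun_prop : Continuous fun r : ℝ => (c + c₀) * r).tendsto' 0 0
            (by simp)).mono_left nhdsWithin_le_nhds)
        filter_upwards [self_mem_nhdsWithin] with r hr
        have hr0 : 0 ≤ r := hr.1
        rw [slope_def_field, hQ0, sub_zero, sub_zero, Real.norm_eq_abs, abs_div, abs_of_nonneg hr0]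
        refine div_le_of_le_mul₀ hr0 (mul_nonneg (by linarith) hr0) ?_
        linarith [hQ2 r hr0]
      · exact (hQd r hr).hasDerivWithinAt
    · rcases hr₀.1.eq_or_lt with h0 | h0
      · simp [← h0]
      · rw [abs_div, abs_of_pos h0, div_lt_one h0, hQq r₀ h0]
        exact (hq r₀ h0).1
    · rcases hr.1.eq_or_lt with rfl | hr'
      · simp [hQ0]
      · have := hmax hr
        simp only [mem_ofPred_eq] at this
        rwa [abs_div, abs_of_pos hr', div_le_iff₀ hr'] at this
  obtain ⟨Q₁, hz₁, he₁, hd₁, hc₁, ρ₁, hn₁, hl₁, hb₁⟩ := key q₁ h₁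
  obtain ⟨Q₂, hz₂, he₂, hd₂, hc₂, ρ₂, hn₂, hl₂, hb₂⟩ := key q₂ h₂
  set ρ := max ρ₁ ρ₂ with hρ
  have hρ0 : 0 ≤ ρ := hn₁.trans (le_max_left _ _)
  have hρ1 : ρ < 1 := max_lt hl₁ hl₂
  set σ := Real.sqrt (1 - ρ ^ 2) with hσ
  have hσ0 : 0 < σ := Real.sqrt_pos.2 (by nlinarith)
  have hσ2 : σ ^ 2 = 1 - ρ ^ 2 := Real.sq_sqrt (by nlinarith)
  rw [← he₁ R hR, ← he₂ R hR]
  -- On the sector `|x| ≤ ρ r` the square root stays at least `σ = √(1 - ρ²)`, which makes `v`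
  -- Lipschitz uniformly in `r`.
  refine ODE_solution_unique_of_mem_Icc_right (v := v) (s := fun r => {x | |x| ≤ ρ * r})
    (K := Real.toNNReal (c / σ)) (a := 0) (b := R) (fun r hr => ?_)
    (hc₁.mono Icc_subset_Ici_self) (fun r hr => hd₁ r hr.1)
    (fun r hr => (hb₁ r ⟨hr.1, hr.2.le⟩).trans
      (mul_le_mul_of_nonneg_right (le_max_left _ _) hr.1))
    (hc₂.mono Icc_subset_Ici_self) (fun r hr => hd₂ r hr.1)
    (fun r hr => (hb₂ r ⟨hr.1, hr.2.le⟩).trans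
      (mul_le_mul_of_nonneg_right (le_max_right _ _) hr.1)) (by rw [hz₁, hz₂])
    (right_mem_Icc.2 hR.le)
  refine LipschitzOnWith.of_dist_le_mul fun x hx y hy => ?_
  rw [Real.coe_toNNReal _ (div_nonneg hc.le hσ0.le), Real.dist_eq, Real.dist_eq]
  rcases hr.1.eq_or_lt with rfl | hr0
  · simp only [hv, zero_mul, sub_self, abs_zero]
    exact mul_nonneg (div_nonneg hc.le hσ0.le) (abs_nonneg _)
  · have hle : ∀ z : ℝ, |z| ≤ ρ * r → (z / r) ^ 2 ≤ 1 - σ ^ 2 := by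
      intro z hz
      rw [hσ2, sub_sub_cancel, ← sq_abs]
      refine pow_le_pow_left₀ (abs_nonneg _) ?_ 2
      rwa [abs_div, abs_of_pos hr0, div_le_iff₀ hr0]
    have h3 := abs_sqrt_sub_sqrt_le hσ0 (hle x hx) (hle y hy)
    rw [← sub_div, abs_div, abs_of_pos hr0] at h3
    have e1 : v r x - v r y
        = r * c * (Real.sqrt (1 - (x / r) ^ 2) - Real.sqrt (1 - (y / r) ^ 2)) := by
      simp only [hv]
      ring
    rw [e1, abs_mul, abs_of_pos (mul_pos hr0 hc)]
    calc _ ≤ r * c * (|x - y| / r / σ) := mul_le_mul_of_nonneg_left h3 (mul_pos hr0 hc).le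
      _ = c / σ * |x - y| := by field_simp

/-- Radial solutions away from the origin are unique up to an additive constant. -/
theorem radial_solution_unique {c₀ c : ℝ} (hc₀ : 0 < c₀) (hc : 0 < c) {φ ψ : E → ℝ}
    (hφ : IsSolutionOn c₀ c φ {0}ᶜ) (hφr : IsRadialWithZeroSlope φ)
    (hψ : IsSolutionOn c₀ c ψ {0}ᶜ) (hψr : IsRadialWithZeroSlope ψ) :
    ∃ k : ℝ, ∀ x, ψ x = φ x + k := by
  obtain ⟨f, hf, hf0⟩ := hφr
  obtain ⟨g, hg, hg0⟩ := hψr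
  obtain ⟨q₁, h₁⟩ := hφ.exists_flux hf
  obtain ⟨q₂, h₂⟩ := hψ.exists_flux hg
  have hqe : ∀ r, 0 < r → q₁ r = q₂ r := fun r hr =>
    flux_unique hc₀ hc (fun r hr => ⟨(h₁ r hr).1, (h₁ r hr).2.1⟩)
      (fun r hr => ⟨(h₂ r hr).1, (h₂ r hr).2.1⟩) hr
  have hd : ∀ r, 0 < r → HasDerivAt (fun r => g r - f r) 0 r := fun r hr => by
    have := (h₂ r hr).2.2.sub (h₁ r hr).2.2
    rw [hqe r hr, sub_self] at this
    exact this
  have hcont : ContinuousOn (fun r => g r - f r) (Ici 0) := by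
    intro r hr
    rcases (mem_Ici.1 hr).eq_or_lt with rfl | hr
    · exact hg0.continuousWithinAt.sub hf0.continuousWithinAt
    · exact (hd r hr).continuousAt.continuousWithinAt
  refine ⟨g 0 - f 0, fun x => ?_⟩
  have hconst : g ‖x‖ - f ‖x‖ = g 0 - f 0 := by
    refine constant_of_has_deriv_right_zero (f := fun r => g r - f r) (a := 0) (b := ‖x‖)
      (hcont.mono Icc_subset_Ici_self) (fun r hr => ?_) _ ⟨norm_nonneg x, le_rfl⟩
    rcases hr.1.eq_or_lt with rfl | hr
    · exact (hg0.sub hf0).congr_deriv (sub_zero 0)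
    · exact (hd r hr).hasDerivWithinAt
  rw [hf, hg]
  linarith

/-! ### The sine of the angle: comparison, monotonicity, existence, concavity. -/

/-- `s = -f' / √(1 + f'²)` is the sine of the angle of a radial solution `f`. -/
structure IsAngleSine (k c₀ c : ℝ) (s : ℝ → ℝ) : Prop where
  continuousOn : ContinuousOn s (Ici 0)
  mem : ∀ r, 0 ≤ r → s r ∈ Icc 0 k
  hasDerivAt : ∀ r, 0 < r →
    HasDerivAt s (c * Real.sqrt (1 - s r ^ 2) - c₀ - s r / r) r

/-- The slope `s / √(1 - s²)` belonging to the sine `s` of an angle. -/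
noncomputable def slopeOf (s : ℝ) : ℝ := s / Real.sqrt (1 - s ^ 2)

/-- Multiplying the difference by `r` absorbs the singular terms `s / r` and `z / r`. Where `z < s`,
the forcing is larger at `z`, so `r (z - s)` is pushed back up. -/
theorem sub_le_super {c₀ c : ℝ} (hc : 0 ≤ c) {s s' z z' : ℝ → ℝ} (hsc : ContinuousOn s (Ici 0))
    (hzc : ContinuousOn z (Ici 0)) (hz0 : ∀ r, 0 < r → 0 ≤ z r)
    (hs : ∀ r, 0 < r → HasDerivAt s (s' r) r) (hz : ∀ r, 0 < r → HasDerivAt z (z' r) r)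
    (hs' : ∀ r, 0 < r → s' r ≤ c * Real.sqrt (1 - s r ^ 2) - c₀ - s r / r)
    (hz' : ∀ r, 0 < r → c * Real.sqrt (1 - z r ^ 2) - c₀ - z r / r ≤ z' r) {r : ℝ} (hr : 0 < r) :
    s r ≤ z r := by
  have h := nonneg_of_deriv_nonneg_of_neg (d := fun r => r * (z r - s r))
    (d' := fun r => 1 * (z r - s r) + r * (z' r - s' r)) (by fun_prop)
    (fun r hr => (hasDerivAt_id r).mul ((hz r hr).sub (hs r hr))) (by simp)
    (fun r hr hneg => by
      have hlt : z r < s r := by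
        by_contra! h
        exact absurd hneg (not_lt.2 (mul_nonneg hr.le (sub_nonneg.2 h)))
      have hsq : Real.sqrt (1 - s r ^ 2) ≤ Real.sqrt (1 - z r ^ 2) :=
        Real.sqrt_le_sqrt (by nlinarith [hz0 r hr])
      have h1 := mul_le_mul_of_nonneg_left hsq hc
      have h2 := hs' r hr
      have h3 := hz' r hr
      have h5 : 0 ≤ z' r - s' r + (z r - s r) / r := by
        have : z r / r - s r / r = (z r - s r) / r := by ring
        linarith
      have h6 := mul_nonneg hr.le h5
      have h7 : r * (z' r - s' r + (z r - s r) / r) = 1 * (z r - s r) + r * (z' r - s' r) := by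
        field_simp
        ring
      linarith) hr.le
  exact sub_nonneg.1 (nonneg_of_mul_nonneg_right h hr)

namespace Params

variable {k σ c₀ c : ℝ}

theorem sq_le_of_mem (_ : Params k σ c₀ c) {s : ℝ} (hs : s ∈ Icc 0 k) : s ^ 2 ≤ k ^ 2 :=
  pow_le_pow_left₀ hs.1 hs.2 2

theorem sqrt_pos_of_mem (h : Params k σ c₀ c) {s : ℝ} (hs : s ∈ Icc 0 k) :
    0 < Real.sqrt (1 - s ^ 2) :=
  h.σ_pos.trans_le (h.le_sqrt (h.sq_le_of_mem hs))

theorem slopeOf_nonneg (h : Params k σ c₀ c) {s : ℝ} (hs : s ∈ Icc 0 k) : 0 ≤ slopeOf s :=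
  div_nonneg hs.1 (h.sqrt_pos_of_mem hs).le

theorem slopeOf_mono (h : Params k σ c₀ c) {s t : ℝ} (hs : 0 ≤ s) (hst : s ≤ t) (ht : t ≤ k) :
    slopeOf s ≤ slopeOf t := by
  refine div_le_div₀ (hs.trans hst) hst (h.sqrt_pos_of_mem ⟨hs.trans hst, ht⟩)
    (Real.sqrt_le_sqrt ?_)
  nlinarith

theorem slopeOf_k (h : Params k σ c₀ c) : slopeOf k = k / σ := by
  rw [slopeOf, h.sqrt_k]

theorem slopeOf_le (h : Params k σ c₀ c) {s : ℝ} (hs : s ∈ Icc 0 k) : slopeOf s ≤ k / σ := by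
  rw [← h.slopeOf_k]
  exact h.slopeOf_mono hs.1 hs.2 le_rfl

/-- For `l ≥ 1` the dilation `s(l r)` is a super-solution: the chain rule multiplies the nonnegative
forcing by `l` and leaves the curvature term as `s(l r) / r`. Take `l = b / a` and compare at `a`.
-/
theorem monotoneOn (h : Params k σ c₀ c) {s : ℝ → ℝ} (hs : IsAngleSine k c₀ c s) :
    MonotoneOn s (Ioi 0) := by
  intro a ha b hb hab
  have ha' : 0 < a := ha
  have hb' : 0 < b := hb
  set l := b / a with hl
  have hl1 : 1 ≤ l := (one_le_div ha').2 hab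
  have hl0 : 0 < l := by linarith
  have := sub_le_super (r := a) (c₀ := c₀) h.c_pos.le (s := s) (z := fun r => s (l * r))
    (z' := fun r => (c * Real.sqrt (1 - s (l * r) ^ 2) - c₀ - s (l * r) / (l * r)) * l)
    hs.continuousOn
    (hs.continuousOn.comp (by fun_prop) fun r hr => mul_nonneg hl0.le hr)
    (fun r hr => (hs.mem _ (mul_pos hl0 hr).le).1) hs.hasDerivAt
    (fun r hr => by
      have h1 : HasDerivAt (fun r => l * r) l r := by simpa using (hasDerivAt_id r).const_mul l
      exact (hs.hasDerivAt (l * r) (mul_pos hl0 hr)).comp r h1)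
    (fun r hr => le_rfl)
    (fun r hr => by
      have h1 := mul_le_mul_of_nonneg_left
        (h.le_sqrt (h.sq_le_of_mem (hs.mem _ (mul_pos hl0 hr).le))) h.c_pos.le
      rw [h.c_mul] at h1
      have h2 : s (l * r) / (l * r) * l = s (l * r) / r := by field_simp
      rw [sub_mul _ _ l, h2]
      nlinarith) ha'
  rwa [show l * a = b by rw [hl]; field_simp] at this

/-- Existence of a smooth radial solution, with its derivative expressed through the angle. -/
theorem exists_solution (h : Params k σ c₀ c) :
    ∃ (φ : E → ℝ) (f s : ℝ → ℝ), IsAngleSine k c₀ c s ∧ ContDiff ℝ ∞ φ ∧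
      IsSolutionOn c₀ c φ univ ∧ (∀ x, φ x = f ‖x‖) ∧
      (∀ r, 0 ≤ r → HasDerivAt f (-slopeOf (s r)) r) ∧ s 0 = 0 ∧
      ∀ x, ‖gradient φ x‖ = slopeOf (s ‖x‖) := by
  obtain ⟨p, hpreg, hp0, hpk, hode⟩ := h.exists_profile
  have hpc : Continuous fun t => p (max t 0) :=
    hpreg.continuousOn.comp_continuous (by fun_prop) fun t => le_max_right t 0
  have hpos : ∀ t, 0 ≤ t → 0 < 1 - t * p t ^ 2 := fun t ht => by
    nlinarith [hpk t ht, h.σ_pos, h.sq_add_sq]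
  -- If `f(r) = g(r²)`, then `f' = -slopeOf s` with `s = r p(r²)` forces `g' = -p / (2 √(1 - t
  -- p²))`. The `max` continues it to `t < 0`, so that `g` has a two-sided derivative at `0`.
  set G : ℝ → ℝ := fun t => -(p (max t 0) / Real.sqrt (1 - max t 0 * p (max t 0) ^ 2)) / 2 with hG
  have hGc : Continuous G := by
    refine ((hpc.div (continuous_const.sub ((continuous_id.max continuous_const).mul (hpc.pow 2))).sqrt
      fun t => ?_).neg).div_const 2
    exact (Real.sqrt_pos.2 (hpos _ (le_max_right t 0))).ne'
  have hGe : ∀ t, 0 ≤ t → G t = -(p t / Real.sqrt (1 - t * p t ^ 2)) / 2 := fun t ht => by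
    simp only [hG, max_eq_left ht]
  set g : ℝ → ℝ := fun t => ∫ x in (0 : ℝ)..t, G x with hg
  have hgd : ∀ t, HasDerivAt g (G t) t := fun t =>
    intervalIntegral.integral_hasDerivAt_right (hGc.intervalIntegrable _ _)
      hGc.aestronglyMeasurable.stronglyMeasurableAtFilter hGc.continuousAt
  have hgreg : ContDiffOn ℝ ∞ g (Ici 0) := by
    rw [contDiffOn_infty_iff_derivWithin (uniqueDiffOn_Ici 0)]
    refine ⟨fun t _ => (hgd t).differentiableAt.differentiableWithinAt, ?_⟩
    refine ContDiffOn.congr (f := fun t => -(p t / Real.sqrt (1 - t * p t ^ 2)) / 2) ?_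
      fun t ht => by rw [(hgd t).hasDerivWithinAt.derivWithin (uniqueDiffOn_Ici 0 t ht), hGe t ht]
    refine ((hpreg.div ((contDiffOn_const.sub (contDiffOn_id.mul (hpreg.pow 2))).sqrt
      fun t ht => (hpos t ht).ne') fun t ht => ?_).neg).div_const 2
    exact (Real.sqrt_pos.2 (hpos t ht)).ne'
  set s : ℝ → ℝ := fun r => r * p (r ^ 2) with hs
  have hs2 : ∀ r, s r ^ 2 = r ^ 2 * p (r ^ 2) ^ 2 := fun r => by
    simp only [hs]
    ring
  have hgrad : ∀ x : E, gradient (fun y : E => g (‖y‖ ^ 2)) x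
      = (-(p (‖x‖ ^ 2) / Real.sqrt (1 - ‖x‖ ^ 2 * p (‖x‖ ^ 2) ^ 2))) • x := fun x => by
    rw [gradient_comp_norm_sq (hgd _).hasDerivWithinAt, hGe _ (sq_nonneg _)]
    congr 1
    ring
  have hgn : ∀ x : E, ‖gradient (fun y : E => g (‖y‖ ^ 2)) x‖ = slopeOf (s ‖x‖) := fun x => by
    rw [hgrad, norm_smul, norm_neg, norm_div, Real.norm_of_nonneg (hp0 _ (sq_nonneg _)),
      Real.norm_of_nonneg (Real.sqrt_nonneg _), slopeOf, hs2]
    simp only [hs]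
    ring
  have hgn2 : ∀ x : E, 1 / Real.sqrt (1 + ‖gradient (fun y : E => g (‖y‖ ^ 2)) x‖ ^ 2)
      = Real.sqrt (1 - ‖x‖ ^ 2 * p (‖x‖ ^ 2) ^ 2) := fun x => by
    have h0 := hpos (‖x‖ ^ 2) (sq_nonneg _)
    have h1 : 1 + ‖gradient (fun y : E => g (‖y‖ ^ 2)) x‖ ^ 2
        = (1 - ‖x‖ ^ 2 * p (‖x‖ ^ 2) ^ 2)⁻¹ := by
      rw [hgn, slopeOf, div_pow, hs2, Real.sq_sqrt h0.le]
      field_simp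
      ring
    rw [h1, Real.sqrt_inv, one_div, inv_inv]
  have hcd : ContDiff ℝ ∞ (fun y : E => g (‖y‖ ^ 2)) :=
    hgreg.comp_contDiff (contDiff_norm_sq ℝ) fun y => sq_nonneg ‖y‖
  refine ⟨fun x => g (‖x‖ ^ 2), fun r => g (r ^ 2), s, ⟨?_, fun r hr => ⟨?_, ?_⟩, ?_⟩, hcd,
    ⟨(by exact_mod_cast contDiff_infty.1 hcd 2 : ContDiff ℝ 2 _).contDiffOn, fun x _ => ?_⟩, fun x => rfl, fun r hr => ?_,
    by simp [hs], hgn⟩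
  · exact continuousOn_id.mul (hpreg.continuousOn.comp (by fun_prop) fun r _ => sq_nonneg r)
  · exact mul_nonneg hr (hp0 _ (sq_nonneg r))
  · refine le_of_sq_le_sq ?_ h.k_nonneg
    rw [hs2]
    exact hpk _ (sq_nonneg r)
  · intro r hr
    have hr2 : 0 < r ^ 2 := by positivity
    have h1 : HasDerivAt p (derivWithin p (Ici 0) (r ^ 2)) (r ^ 2) :=
      ((hpreg.differentiableOn (by norm_num) (r ^ 2) hr2.le).hasDerivWithinAt).hasDerivAt
        (Ici_mem_nhds hr2)
    have h2 := (hasDerivAt_id r).mul (HasDerivAt.comp r (h₂ := p) (h := fun x => x ^ 2) h1 (hasDerivAt_pow 2 r))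
    refine h2.congr_deriv ?_
    have h3 := hode (r ^ 2) hr2.le
    rw [hs2, ← h3]
    simp only [hs, id, Function.comp_apply]
    field_simp
    push_cast
    ring
  · have hF : (fun y => (1 / Real.sqrt (1 + ‖gradient (fun y : E => g (‖y‖ ^ 2)) y‖ ^ 2)) •
        gradient (fun y : E => g (‖y‖ ^ 2)) y) = fun y : E => (-p (‖y‖ ^ 2)) • y := by
      funext y
      rw [hgn2, hgrad, smul_smul]
      congr 1
      have := (Real.sqrt_pos.2 (hpos (‖y‖ ^ 2) (sq_nonneg _))).ne'
      field_simp
    have h1 : HasDerivWithinAt p (derivWithin p (Ici 0) (‖x‖ ^ 2)) (Ici 0) (‖x‖ ^ 2) :=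
      (hpreg.differentiableOn (by norm_num) (‖x‖ ^ 2) (sq_nonneg ‖x‖)).hasDerivWithinAt
    rw [mcmOperator, hF, divergence_comp_norm_sq_smul (A := fun t => -p t) h1.neg,
      div_eq_mul_one_div c, hgn2]
    have h3 := hode (‖x‖ ^ 2) (sq_nonneg _)
    linarith
  · have h1 := (hgd (r ^ 2)).comp r (hasDerivAt_pow 2 r)
    refine h1.congr_deriv ?_
    rw [hGe _ (sq_nonneg r), slopeOf, hs2]
    simp only [hs]
    push_cast
    ring

/-- A concave nonincreasing profile composed with the convex norm; both properties come from the
sine being nondecreasing and nonnegative. -/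
theorem concaveOn_of_hasDerivAt (h : Params k σ c₀ c) {s f : ℝ → ℝ} (hs : IsAngleSine k c₀ c s)
    (hf : ∀ r, 0 ≤ r → HasDerivAt f (-slopeOf (s r)) r) :
    ConcaveOn ℝ univ (fun x : E => f ‖x‖) := by
  have hfc : ContinuousOn f (Ici 0) := fun r hr => (hf r hr).continuousAt.continuousWithinAt
  have hfd : DifferentiableOn ℝ f (interior (Ici 0)) := fun r hr => by
    rw [interior_Ici] at hr
    exact (hf r (le_of_lt hr)).differentiableAt.differentiableWithinAt
  have hconc : ConcaveOn ℝ (Ici 0) f := by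
    refine AntitoneOn.concaveOn_of_deriv (convex_Ici 0) hfc hfd ?_
    rw [interior_Ici]
    intro a ha b hb hab
    rw [(hf a (le_of_lt ha)).deriv, (hf b (le_of_lt hb)).deriv, neg_le_neg_iff]
    exact h.slopeOf_mono (hs.mem a (le_of_lt ha)).1 (h.monotoneOn hs ha hb hab)
      (hs.mem b (le_of_lt hb)).2
  have hanti : AntitoneOn f (Ici 0) := by
    refine antitoneOn_of_deriv_nonpos (convex_Ici 0) hfc hfd fun r hr => ?_
    rw [interior_Ici] at hr
    rw [(hf r (le_of_lt hr)).deriv]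
    exact neg_nonpos.2 (h.slopeOf_nonneg (hs.mem r (le_of_lt hr)))
  have hsub : (norm '' (univ : Set E)) ⊆ Ici (0 : ℝ) := by
    rintro _ ⟨x, -, rfl⟩
    exact norm_nonneg x
  have himg : (norm '' (univ : Set E)) = Ici (0 : ℝ) := by
    refine hsub.antisymm fun r hr => ⟨EuclideanSpace.single 0 r, trivial, ?_⟩
    simpa using hr
  refine ConcaveOn.comp_convexOn (g := f) (f := fun x : E => ‖x‖) ?_ convexOn_univ_norm ?_
  · rw [himg]
    exact hconc
  · rw [himg]
    exact hanti

end Params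

/-! ### Expansion at infinity. -/

/-- `M / r³` is a barrier: half of the decay `l M / r³` pays for the derivative of the barrier once
`r ≥ 6 / l`, the other half pays for the source once `M ≥ 2 K / l`. -/
theorem le_div_cube_of_deriv_le {e e' : ℝ → ℝ} {l K R₀ : ℝ} (hl : 0 < l) (hK : 0 ≤ K)
    (hR₀ : 0 < R₀) (he : ∀ r, R₀ ≤ r → HasDerivAt e (e' r) r)
    (h : ∀ r, R₀ ≤ r → 0 < e r → e' r ≤ -(l * e r) + K / r ^ 3) :
    ∃ M R₁, ∀ r, R₁ ≤ r → e r ≤ M / r ^ 3 := by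
  set R₁ := max R₀ (6 / l) with hR₁
  have hR₁p : 0 < R₁ := hR₀.trans_le (le_max_left _ _)
  set M := max (2 * K / l) (R₁ ^ 3 * |e R₁|) with hM
  have hM0 : 0 ≤ M := le_trans (by positivity) (le_max_left _ _)
  have hpow : ∀ r, R₁ ≤ r → HasDerivAt (fun r : ℝ => M / r ^ 3) (-(3 * M / r ^ 4)) r := by
    intro r hr
    have hr0 : r ≠ 0 := (hR₁p.trans_le hr).ne'
    refine ((hasDerivAt_const r M).div (hasDerivAt_pow 3 r) (pow_ne_zero 3 hr0)).congr_deriv ?_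
    push_cast
    field_simp
    ring
  refine ⟨M, R₁, fun r hr => ?_⟩
  have := nonneg_of_deriv_nonneg_of_neg (a := R₁) (d := fun r => M / r ^ 3 - e r)
    (fun r hr => ((hpow r hr).sub (he r ((le_max_left _ _).trans hr))).continuousAt.continuousWithinAt)
    (fun r hr => (hpow r hr.le).sub (he r ((le_max_left _ _).trans hr.le))) ?_ ?_ hr
  · simpa using this
  · rw [sub_nonneg, le_div_iff₀ (by positivity), mul_comm]
    exact (mul_le_mul_of_nonneg_left (le_abs_self _) (by positivity)).trans (le_max_right _ _)
  · intro r hr hneg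
    have hr0 : 0 < r := hR₁p.trans hr
    have hME : M / r ^ 3 < e r := by linarith
    have hpos : 0 ≤ M / r ^ 3 := by positivity
    have h1 := h r ((le_max_left _ _).trans hr.le) (hpos.trans_lt hME)
    have h2 : l * (M / r ^ 3) ≤ l * e r := mul_le_mul_of_nonneg_left hME.le hl.le
    have h3 : 3 * M / r ^ 4 ≤ l * (M / r ^ 3) / 2 := by
      have h6 : 6 ≤ l * r := by
        rw [mul_comm, ← div_le_iff₀ hl]
        exact (le_max_right _ _).trans hr.le
      rw [show l * (M / r ^ 3) / 2 = (l * r) * M / 2 / r ^ 4 by field_simp]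
      refine div_le_div_of_nonneg_right ?_ (by positivity)
      nlinarith
    have h4 : K / r ^ 3 ≤ l * (M / r ^ 3) / 2 := by
      rw [show l * (M / r ^ 3) / 2 = l * M / 2 / r ^ 3 by ring]
      refine div_le_div_of_nonneg_right ?_ (by positivity)
      have : 2 * K / l ≤ M := le_max_left _ _
      rw [div_le_iff₀ hl] at this
      linarith
    linarith

/-- `D - K / (2 r²)` increases and `D + K / (2 r²)` decreases, so all values of the first lie below
all values of the second. The supremum of the first separates them. -/
theorem exists_isBigO_sub_const {D D' : ℝ → ℝ} {K R₀ : ℝ} (hK : 0 ≤ K) (hR₀ : 0 < R₀)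
    (hD : ∀ r, R₀ ≤ r → HasDerivAt D (D' r) r) (hb : ∀ r, R₀ ≤ r → |D' r| ≤ K / r ^ 3) :
    ∃ C, (fun r => D r - C) =O[atTop] fun r => 1 / r ^ 2 := by
  have hpow : ∀ r, R₀ ≤ r → HasDerivAt (fun r : ℝ => K / 2 / r ^ 2) (-(K / r ^ 3)) r := by
    intro r hr
    have hr0 : r ≠ 0 := (hR₀.trans_le hr).ne'
    refine ((hasDerivAt_const r (K / 2)).div (hasDerivAt_pow 2 r)
      (pow_ne_zero 2 hr0)).congr_deriv ?_
    push_cast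
    field_simp
    ring
  have hint : interior (Ici R₀) ⊆ Ici R₀ := interior_subset
  have hdown : MonotoneOn (fun r => D r - K / 2 / r ^ 2) (Ici R₀) := by
    have hd : ∀ r ∈ Ici R₀, HasDerivAt (fun r => D r - K / 2 / r ^ 2) (D' r - -(K / r ^ 3)) r :=
      fun r hr => (hD r hr).sub (hpow r hr)
    refine monotoneOn_of_deriv_nonneg (convex_Ici R₀)
      (fun r hr => (hd r hr).continuousAt.continuousWithinAt)
      (fun r hr => (hd r (hint hr)).differentiableAt.differentiableWithinAt) fun r hr => ?_
    rw [(hd r (hint hr)).deriv]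
    linarith [(abs_le.1 (hb r (hint hr))).1]
  have hup : AntitoneOn (fun r => D r + K / 2 / r ^ 2) (Ici R₀) := by
    have hd : ∀ r ∈ Ici R₀, HasDerivAt (fun r => D r + K / 2 / r ^ 2) (D' r + -(K / r ^ 3)) r :=
      fun r hr => (hD r hr).add (hpow r hr)
    refine antitoneOn_of_deriv_nonpos (convex_Ici R₀)
      (fun r hr => (hd r hr).continuousAt.continuousWithinAt)
      (fun r hr => (hd r (hint hr)).differentiableAt.differentiableWithinAt) fun r hr => ?_
    rw [(hd r (hint hr)).deriv]
    linarith [(abs_le.1 (hb r (hint hr))).2]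
  have hcross : ∀ a ∈ Ici R₀, ∀ b ∈ Ici R₀,
      D a - K / 2 / a ^ 2 ≤ D b + K / 2 / b ^ 2 := by
    intro a ha b hb
    have hm : max a b ∈ Ici R₀ := le_trans (mem_Ici.1 ha) (le_max_left _ _)
    have h1 := hdown ha hm (le_max_left _ _)
    have h2 := hup hb hm (le_max_right _ _)
    have h3 : 0 ≤ K / 2 / (max a b) ^ 2 := by positivity
    simp only at h1 h2
    linarith
  set C := sSup ((fun r => D r - K / 2 / r ^ 2) '' Ici R₀) with hC
  have hbdd : BddAbove ((fun r => D r - K / 2 / r ^ 2) '' Ici R₀) :=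
    ⟨D R₀ + K / 2 / R₀ ^ 2, by
      rintro _ ⟨a, ha, rfl⟩
      exact hcross a ha R₀ self_mem_Ici⟩
  refine ⟨C, IsBigO.of_bound (K / 2) ?_⟩
  filter_upwards [eventually_ge_atTop R₀] with r hr
  have h1 : D r - K / 2 / r ^ 2 ≤ C := le_csSup hbdd ⟨r, hr, rfl⟩
  have h2 : C ≤ D r + K / 2 / r ^ 2 := csSup_le ⟨_, R₀, self_mem_Ici, rfl⟩ (by
    rintro _ ⟨a, ha, rfl⟩
    exact hcross a ha r hr)
  rw [Real.norm_eq_abs, Real.norm_of_nonneg (by positivity), mul_one_div]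
  exact abs_le.2 ⟨by linarith, by linarith⟩

theorem isBigO_inv_pow_atTop {m n : ℕ} (h : m ≤ n) :
    (fun r : ℝ => 1 / r ^ n) =O[atTop] fun r => 1 / r ^ m := by
  refine IsBigO.of_bound 1 ?_
  filter_upwards [eventually_ge_atTop 1] with r hr
  have : 0 < r := by linarith
  rw [Real.norm_of_nonneg (by positivity), Real.norm_of_nonneg (by positivity), one_mul]
  exact one_div_le_one_div_of_le (by positivity) (pow_le_pow_right₀ hr h)

namespace Params

variable {k σ c₀ c : ℝ}

/-- Second order expansion of the sine of the angle. -/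
noncomputable def sineApprox (k σ c r : ℝ) : ℝ := k - σ / c / r - 1 / (2 * k * c ^ 2) / r ^ 2

/-- The coefficients of `sineApprox` are those for which `1 - sineApprox²` agrees with the square
`(σ + k / (c r))²` up to `r⁻³`. No `r⁻²` term appears in the root because at that order `s'` and `-s
/ r` both equal `σ / (c r²)`. -/
theorem sqrt_sineApprox (h : Params k σ c₀ c) (hk : 0 < k) :
    ∃ K, 0 ≤ K ∧ ∀ᶠ r in atTop, k / 2 ≤ sineApprox k σ c r ∧ sineApprox k σ c r ≤ k ∧
      |Real.sqrt (1 - sineApprox k σ c r ^ 2) - (σ + k / c / r)| ≤ K / r ^ 3 := by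
  have hc := h.c_pos
  have hσ := h.σ_pos
  have hlim : Tendsto (fun r : ℝ => sineApprox k σ c r) atTop (𝓝 (k - 0 - 0)) :=
    (tendsto_const_nhds.sub (tendsto_const_nhds.div_atTop tendsto_id)).sub
      (tendsto_const_nhds.div_atTop (tendsto_pow_atTop two_ne_zero))
  rw [sub_zero, sub_zero] at hlim
  refine ⟨(σ / (k * c ^ 3) + 1 / (4 * k ^ 2 * c ^ 4)) / σ, by positivity, ?_⟩
  filter_upwards [hlim.eventually_const_le (show k / 2 < k by linarith), eventually_ge_atTop 1]
    with r hr hr1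
  have hr0 : 0 < r := by linarith
  have hle : sineApprox k σ c r ≤ k := by
    have h1 : 0 ≤ σ / c / r := by positivity
    have h2 : 0 ≤ 1 / (2 * k * c ^ 2) / r ^ 2 := by positivity
    unfold sineApprox
    linarith
  refine ⟨hr, hle, ?_⟩
  have hS : sineApprox k σ c r ^ 2 ≤ k ^ 2 := h.sq_le_of_mem ⟨by linarith, hle⟩
  have hX := h.le_sqrt hS
  have hX2 : Real.sqrt (1 - sineApprox k σ c r ^ 2) ^ 2 = 1 - sineApprox k σ c r ^ 2 :=
    Real.sq_sqrt (by nlinarith [h.sq_add_sq])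
  set X := Real.sqrt (1 - sineApprox k σ c r ^ 2)
  have hB : 0 ≤ k / c / r := by positivity
  have hdiff : X ^ 2 - (σ + k / c / r) ^ 2
      = -((σ / (k * c ^ 3) + 1 / (4 * k ^ 2 * c ^ 4) / r) / r ^ 3) := by
    have hs1 := h.sq_add_sq
    rw [hX2, sineApprox]
    linear_combination (norm := (field_simp; ring)) (-(1 + 1 / (c ^ 2 * r ^ 2))) * hs1
  have hprod : |X - (σ + k / c / r)| * (X + (σ + k / c / r))
      = (σ / (k * c ^ 3) + 1 / (4 * k ^ 2 * c ^ 4) / r) / r ^ 3 := by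
    have hpos : 0 ≤ (σ / (k * c ^ 3) + 1 / (4 * k ^ 2 * c ^ 4) / r) / r ^ 3 := by positivity
    rw [← abs_of_nonneg hpos, ← abs_neg ((σ / (k * c ^ 3) + 1 / (4 * k ^ 2 * c ^ 4) / r) / r ^ 3),
      ← hdiff, ← abs_of_nonneg (by linarith : 0 ≤ X + (σ + k / c / r)), ← abs_mul]
    congr 1
    ring
  have h1 : |X - (σ + k / c / r)| * σ
      ≤ (σ / (k * c ^ 3) + 1 / (4 * k ^ 2 * c ^ 4)) / r ^ 3 := by
    calc |X - (σ + k / c / r)| * σ ≤ |X - (σ + k / c / r)| * (X + (σ + k / c / r)) :=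
          mul_le_mul_of_nonneg_left (by linarith) (abs_nonneg _)
      _ = _ := hprod
      _ ≤ _ := by
        refine div_le_div_of_nonneg_right ?_ (by positivity)
        have : 1 / (4 * k ^ 2 * c ^ 4) / r ≤ 1 / (4 * k ^ 2 * c ^ 4) :=
          div_le_self (by positivity) hr1
        linarith
  rw [← le_div_iff₀ hσ] at h1
  exact h1.trans_eq (div_right_comm _ _ _)

theorem sine_expansion (h : Params k σ c₀ c) (hk : 0 < k) {s : ℝ → ℝ}
    (hs : IsAngleSine k c₀ c s) :
    (fun r => s r - sineApprox k σ c r) =O[atTop] fun r => 1 / r ^ 3 := by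
  have hc := h.c_pos
  have hσ := h.σ_pos
  obtain ⟨K, hK, hKr⟩ := h.sqrt_sineApprox hk
  obtain ⟨R, hR⟩ := eventually_atTop.1 (hKr.and (eventually_ge_atTop 1))
  set R₀ := max R 1 with hR₀
  have hR₀p : 0 < R₀ := one_pos.trans_le (le_max_right _ _)
  set L := c * K + 1 / (2 * k * c ^ 2) with hL
  have hL0 : 0 ≤ L := by positivity
  have hSd : ∀ r, R₀ ≤ r → HasDerivAt (sineApprox k σ c)
      (σ / c / r ^ 2 + 1 / (k * c ^ 2) / r ^ 3) r := by
    intro r hr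
    have hr0 : r ≠ 0 := (hR₀p.trans_le hr).ne'
    refine (((hasDerivAt_const r k).sub ((hasDerivAt_const r (σ / c)).div (hasDerivAt_id r) hr0)).sub
      ((hasDerivAt_const r (1 / (2 * k * c ^ 2))).div (hasDerivAt_pow 2 r)
        (pow_ne_zero 2 hr0))).congr_deriv ?_
    simp only [id]
    push_cast
    field_simp
    ring
  set e' : ℝ → ℝ := fun r => c * Real.sqrt (1 - s r ^ 2) - c₀ - s r / r
    - (σ / c / r ^ 2 + 1 / (k * c ^ 2) / r ^ 3) with he'
  have hed : ∀ r, R₀ ≤ r → HasDerivAt (fun r => s r - sineApprox k σ c r) (e' r) r := fun r hr =>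
    (hs.hasDerivAt r (hR₀p.trans_le hr)).sub (hSd r hr)
  have hres : ∀ r, R₀ ≤ r →
      |e' r - (c * (Real.sqrt (1 - s r ^ 2) - Real.sqrt (1 - sineApprox k σ c r ^ 2))
        - (s r - sineApprox k σ c r) / r)| ≤ L / r ^ 3 := by
    intro r hr
    have hr0 : 0 < r := hR₀p.trans_le hr
    obtain ⟨⟨-, -, h3⟩, -⟩ := hR r ((le_max_left _ _).trans hr)
    have e1 : e' r - (c * (Real.sqrt (1 - s r ^ 2) - Real.sqrt (1 - sineApprox k σ c r ^ 2))
        - (s r - sineApprox k σ c r) / r)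
        = c * (Real.sqrt (1 - sineApprox k σ c r ^ 2) - (σ + k / c / r))
          - 1 / (2 * k * c ^ 2) / r ^ 3 := by
      simp only [he']
      rw [← h.c_mul]
      generalize Real.sqrt (1 - sineApprox k σ c r ^ 2) = X
      generalize Real.sqrt (1 - s r ^ 2) = Y
      unfold sineApprox
      field_simp
      ring
    rw [e1]
    refine (abs_sub _ _).trans ?_
    rw [abs_mul, abs_of_pos hc, abs_of_nonneg (by positivity : 0 ≤ 1 / (2 * k * c ^ 2) / r ^ 3), hL,
      add_div]
    have := mul_le_mul_of_nonneg_left h3 hc.le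
    rw [← mul_div_assoc] at this
    linarith
  -- The contraction rate: `X + Y ≤ 2` and `a + b ≥ k / 2` give `k / 4`. As `sineApprox ≥ k / 2` and
  -- `s ≥ 0`, it is not necessary to know beforehand that `s → k`.
  have hdiff : ∀ a b : ℝ, 0 ≤ b → b < a → a ≤ k → k / 2 ≤ a + b →
      c * (Real.sqrt (1 - a ^ 2) - Real.sqrt (1 - b ^ 2)) ≤ -(c * k / 4 * (a - b)) := by
    intro a b hb hab hak hsum
    have hk1 := h.k_lt_one
    have ha2 : Real.sqrt (1 - a ^ 2) ^ 2 = 1 - a ^ 2 := Real.sq_sqrt (by nlinarith)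
    have hb2 : Real.sqrt (1 - b ^ 2) ^ 2 = 1 - b ^ 2 := Real.sq_sqrt (by nlinarith)
    have ha1 : Real.sqrt (1 - a ^ 2) ≤ 1 := by
      rw [Real.sqrt_le_left zero_le_one]
      nlinarith
    have hb1 : Real.sqrt (1 - b ^ 2) ≤ 1 := by
      rw [Real.sqrt_le_left zero_le_one]
      nlinarith
    have hlt : Real.sqrt (1 - a ^ 2) ≤ Real.sqrt (1 - b ^ 2) := Real.sqrt_le_sqrt (by nlinarith)
    set X := Real.sqrt (1 - a ^ 2)
    set Y := Real.sqrt (1 - b ^ 2)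
    have h1 : (Y - X) * (X + Y) = (a - b) * (a + b) := by linear_combination hb2 - ha2
    have h2 : k / 4 * (a - b) ≤ Y - X := by nlinarith
    nlinarith
  have hdecay : ∀ r, R₀ ≤ r → 0 < s r - sineApprox k σ c r →
      e' r ≤ -(c * k / 4 * (s r - sineApprox k σ c r)) + L / r ^ 3 := by
    intro r hr hpos
    have hr0 : 0 < r := hR₀p.trans_le hr
    obtain ⟨⟨h1, h2, -⟩, -⟩ := hR r ((le_max_left _ _).trans hr)
    have hm := hs.mem r hr0.le
    have h3 := hdiff (s r) (sineApprox k σ c r) (by linarith) (by linarith) hm.2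
      (by linarith [hm.1])
    have h4 := (abs_le.1 (hres r hr)).2
    have h5 : 0 ≤ (s r - sineApprox k σ c r) / r := div_nonneg hpos.le hr0.le
    linarith
  have hdecay' : ∀ r, R₀ ≤ r → 0 < -(s r - sineApprox k σ c r) →
      -e' r ≤ -(c * k / 4 * -(s r - sineApprox k σ c r)) + L / r ^ 3 := by
    intro r hr hpos
    have hr0 : 0 < r := hR₀p.trans_le hr
    obtain ⟨⟨h1, h2, -⟩, -⟩ := hR r ((le_max_left _ _).trans hr)
    have hm := hs.mem r hr0.le
    have h3 := hdiff (sineApprox k σ c r) (s r) hm.1 (by linarith) h2 (by linarith [hm.1])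
    have h4 := (abs_le.1 (hres r hr)).1
    have h5 : (s r - sineApprox k σ c r) / r ≤ 0 := div_nonpos_of_nonpos_of_nonneg (by linarith) hr0.le
    linarith
  have hl : 0 < c * k / 4 := by positivity
  obtain ⟨M₁, R₁, hM₁⟩ := le_div_cube_of_deriv_le hl hL0 hR₀p hed hdecay
  obtain ⟨M₂, R₂, hM₂⟩ := le_div_cube_of_deriv_le hl hL0 hR₀p (fun r hr => (hed r hr).neg) hdecay'
  refine IsBigO.of_bound (max M₁ M₂) ?_
  filter_upwards [eventually_ge_atTop R₁, eventually_ge_atTop R₂, eventually_gt_atTop 0]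
    with r h1 h2 hr0
  rw [Real.norm_eq_abs, Real.norm_of_nonneg (by positivity), mul_one_div]
  have e1 := hM₁ r h1
  have e2 := hM₂ r h2
  have e3 : M₁ / r ^ 3 ≤ max M₁ M₂ / r ^ 3 :=
    div_le_div_of_nonneg_right (le_max_left _ _) (by positivity)
  have e4 : M₂ / r ^ 3 ≤ max M₁ M₂ / r ^ 3 :=
    div_le_div_of_nonneg_right (le_max_right _ _) (by positivity)
  simp only [Pi.neg_apply] at e2
  exact abs_le.2 ⟨by linarith, by linarith⟩

/-- Replace the numerator and the root in `s / √(1 - s²)` by their expansions; the denominator is at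
least `σ`, so the errors stay `O(r⁻³)`. -/
theorem slope_expansion (h : Params k σ c₀ c) (hk : 0 < k) {s : ℝ → ℝ}
    (hs : IsAngleSine k c₀ c s) :
    (fun r => slopeOf (s r) - (k / σ - 1 / (c₀ * σ) / r
      + (2 - 3 * σ ^ 2) / (c₀ ^ 2 * (2 * σ * k)) / r ^ 2)) =O[atTop] fun r => 1 / r ^ 3 := by
  have hc := h.c_pos
  have hσ := h.σ_pos
  have hc₀ := h.c₀_pos
  obtain ⟨K, hK, hKr⟩ := h.sqrt_sineApprox hk
  set b := (2 - 3 * σ ^ 2) / (c₀ ^ 2 * (2 * σ * k)) with hb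
  set W : ℝ → ℝ := fun r => k / σ - 1 / (c₀ * σ) / r + b / r ^ 2 with hW
  have hsS := h.sine_expansion hk hs
  have hXY : (fun r => Real.sqrt (1 - s r ^ 2) - Real.sqrt (1 - sineApprox k σ c r ^ 2))
      =O[atTop] fun r => 1 / r ^ 3 := by
    refine IsBigO.trans (IsBigO.of_bound (1 / σ) ?_) hsS
    filter_upwards [hKr, eventually_gt_atTop 0] with r hr hr0
    rw [Real.norm_eq_abs, Real.norm_eq_abs, one_div_mul_eq_div]
    refine abs_sqrt_sub_sqrt_le hσ ?_ ?_
    · linarith [h.sq_le_of_mem (hs.mem r hr0.le), h.sq_add_sq]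
    · linarith [h.sq_le_of_mem (s := sineApprox k σ c r) ⟨by linarith [hr.1], hr.2.1⟩, h.sq_add_sq]
  have hYB : (fun r => Real.sqrt (1 - sineApprox k σ c r ^ 2) - (σ + k / c / r))
      =O[atTop] fun r : ℝ => 1 / r ^ 3 := by
    refine IsBigO.of_bound K ?_
    filter_upwards [hKr, eventually_gt_atTop 0] with r hr hr0
    rw [Real.norm_eq_abs, Real.norm_of_nonneg (by positivity), mul_one_div]
    exact hr.2.2
  have hXB : (fun r => (σ + k / c / r) - Real.sqrt (1 - s r ^ 2))
      =O[atTop] fun r => 1 / r ^ 3 := by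
    refine (hXY.add hYB).neg_left.congr_left fun r => ?_
    ring
  have hWlim : Tendsto W atTop (𝓝 (k / σ - 0 + 0)) :=
    (tendsto_const_nhds.sub (tendsto_const_nhds.div_atTop tendsto_id)).add
      (tendsto_const_nhds.div_atTop (tendsto_pow_atTop two_ne_zero))
  have hWB : (fun r => W r * ((σ + k / c / r) - Real.sqrt (1 - s r ^ 2)))
      =O[atTop] fun r => 1 / r ^ 3 := by
    simpa using (hWlim.isBigO_one ℝ).mul hXB
  -- `W` is the quotient of `sineApprox` by `σ + k / (c r)` to second order; the remainder is
  -- exactly `-(b k / c) r⁻³`.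
  have hSW : (fun r => sineApprox k σ c r - W r * (σ + k / c / r))
      =O[atTop] fun r : ℝ => 1 / r ^ 3 := by
    refine (isBigO_refl (fun r : ℝ => 1 / r ^ 3) atTop).const_mul_left (-(b * (k / c))) |>.congr' ?_
      EventuallyEq.rfl
    filter_upwards [eventually_gt_atTop 0] with r hr0
    have hs1 := h.sq_add_sq
    have hk2 : k ^ 2 = 1 - σ ^ 2 := by linarith
    simp only [hW, hb, sineApprox, ← h.c_mul]
    field_simp
    ring_nf
    simp only [show k ^ 3 = k ^ 2 * k by ring, hk2]
    ring
  have hnum := (hsS.add hWB).add hSW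
  have hinv : (fun r => 1 / Real.sqrt (1 - s r ^ 2)) =O[atTop] fun _ => (1 : ℝ) := by
    refine IsBigO.of_bound (1 / σ) ?_
    filter_upwards [eventually_gt_atTop 0] with r hr0
    rw [Real.norm_of_nonneg (by positivity), norm_one, mul_one]
    exact one_div_le_one_div_of_le hσ (h.le_sqrt (h.sq_le_of_mem (hs.mem r hr0.le)))
  have hfin := hinv.mul hnum
  simp only [one_mul] at hfin
  refine hfin.congr' ?_ EventuallyEq.rfl
  filter_upwards [eventually_gt_atTop 0] with r hr0
  have := (h.sqrt_pos_of_mem (hs.mem r hr0.le)).ne'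
  simp only [slopeOf, hW]
  field_simp
  ring

theorem exists_radial_expansion (h : Params k σ c₀ c) (hk : 0 < k) {s f : ℝ → ℝ}
    (hs : IsAngleSine k c₀ c s) (hf : ∀ r, 0 ≤ r → HasDerivAt f (-slopeOf (s r)) r) :
    ∃ C, (fun r => f r - (-(k / σ) * r + 1 / (c₀ * σ) * Real.log r + C
      + (2 - 3 * σ ^ 2) / (c₀ ^ 2 * (2 * σ * k) * r))) =O[atTop] fun r => 1 / r ^ 2 := by
  set b := (2 - 3 * σ ^ 2) / (c₀ ^ 2 * (2 * σ * k)) with hb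
  obtain ⟨K, hK, hbound⟩ := (h.slope_expansion hk hs).exists_nonneg
  obtain ⟨R, hR⟩ := eventually_atTop.1 hbound.bound
  have hD : ∀ r, max R 1 ≤ r →
      HasDerivAt (fun r => f r - (-(k / σ) * r + 1 / (c₀ * σ) * Real.log r + b / r))
        (-slopeOf (s r) - (-(k / σ) * 1 + 1 / (c₀ * σ) * r⁻¹ + -(b / r ^ 2))) r := by
    intro r hr
    have hr0 : 0 < r := one_pos.trans_le ((le_max_right _ _).trans hr)
    refine (hf r hr0.le).sub ((((hasDerivAt_id r).const_mul _).add
      ((Real.hasDerivAt_log hr0.ne').const_mul _)).add ?_)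
    exact ((hasDerivAt_const r b).div (hasDerivAt_id r) hr0.ne').congr_deriv (by simp; ring)
  obtain ⟨C, hC⟩ := exists_isBigO_sub_const hK (one_pos.trans_le (le_max_right _ _)) hD
    fun r hr => by
      have hr0 : 0 < r := one_pos.trans_le ((le_max_right _ _).trans hr)
      have := hR r ((le_max_left _ _).trans hr)
      rw [Real.norm_eq_abs, Real.norm_of_nonneg (by positivity), mul_one_div] at this
      rw [← abs_neg]
      convert this using 2
      ring
  refine ⟨C, hC.congr_left fun r => ?_⟩
  have : (2 - 3 * σ ^ 2) / (c₀ ^ 2 * (2 * σ * k) * r) = b / r := by rw [hb, div_div]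
  rw [this]
  ring

end Params

/-! ### Bessel moments and the ratio `I₁ / I₀`. -/

/-- The moments `∫ (cos θ)ᵐ exp (z cos θ) dθ` over a period; `m = 0` gives `2π I₀(z)` for the
modified Bessel function `I₀`. -/
noncomputable def besselMoment (m : ℕ) (z : ℝ) : ℝ :=
  ∫ θ in (-Real.pi)..Real.pi, Real.cos θ ^ m * Real.exp (z * Real.cos θ)

theorem hasDerivAt_besselMoment (m : ℕ) (z : ℝ) :
    HasDerivAt (besselMoment m) (besselMoment (m + 1) z) z := by
  refine (intervalIntegral.hasDerivAt_integral_of_dominated_loc_of_deriv_le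
    (bound := fun _ => Real.exp (|z| + 1))
    (F := fun z θ => Real.cos θ ^ m * Real.exp (z * Real.cos θ))
    (F' := fun z θ => Real.cos θ ^ (m + 1) * Real.exp (z * Real.cos θ))
    (Metric.ball_mem_nhds z one_pos) ?_ ?_ ?_ ?_ ?_ ?_).2
  · exact Eventually.of_forall fun x => (by fun_prop : Continuous _).aestronglyMeasurable
  · exact (by fun_prop : Continuous _).intervalIntegrable _ _
  · exact (by fun_prop : Continuous _).aestronglyMeasurable
  · refine Eventually.of_forall fun θ _ x hx => ?_
    have hx1 : |x| ≤ |z| + 1 := by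
      have := abs_sub_abs_le_abs_sub x z
      rw [Metric.mem_ball, Real.dist_eq] at hx
      linarith
    have h1 : |x * Real.cos θ| ≤ |z| + 1 := by
      rw [abs_mul]
      nlinarith [Real.abs_cos_le_one θ, abs_nonneg x, abs_nonneg (Real.cos θ)]
    rw [norm_mul, norm_pow, Real.norm_eq_abs, Real.norm_of_nonneg (Real.exp_pos _).le]
    calc |Real.cos θ| ^ (m + 1) * Real.exp (x * Real.cos θ)
        ≤ 1 * Real.exp (|z| + 1) := by
          refine mul_le_mul (pow_le_one₀ (abs_nonneg _) (Real.abs_cos_le_one θ))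
            (Real.exp_le_exp.2 ((le_abs_self _).trans h1)) (Real.exp_pos _).le zero_le_one
      _ = _ := one_mul _
  · exact intervalIntegrable_const
  · refine Eventually.of_forall fun θ _ x _ => ?_
    have h1 : HasDerivAt (fun x => x * Real.cos θ) (Real.cos θ) x := by
      simpa using (hasDerivAt_id x).mul_const (Real.cos θ)
    exact (h1.exp.const_mul (Real.cos θ ^ m)).congr_deriv (by ring)

theorem besselMoment_zero_pos (z : ℝ) : 0 < besselMoment 0 z := by
  refine intervalIntegral.intervalIntegral_pos_of_pos
    ((by fun_prop : Continuous _).intervalIntegrable _ _) (fun θ => ?_) (by linarith [Real.pi_pos])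
  positivity

/-- Integrate the derivative of `sin θ · exp (z cos θ)` over a period. With the moments as
successive derivatives, this is Bessel's equation for `I₀`. -/
theorem besselMoment_one_eq (z : ℝ) :
    besselMoment 1 z = z * (besselMoment 0 z - besselMoment 2 z) := by
  have hd : ∀ θ ∈ uIcc (-Real.pi) Real.pi,
      HasDerivAt (fun θ => Real.sin θ * Real.exp (z * Real.cos θ))
      (Real.cos θ * Real.exp (z * Real.cos θ)
        + Real.sin θ * (Real.exp (z * Real.cos θ) * (z * -Real.sin θ))) θ := fun θ _ =>
    (Real.hasDerivAt_sin θ).mul ((Real.hasDerivAt_cos θ).const_mul z).exp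
  have hI := intervalIntegral.integral_eq_sub_of_hasDerivAt hd
    ((by fun_prop : Continuous _).intervalIntegrable _ _)
  simp only [Real.sin_pi, Real.sin_neg, neg_zero, zero_mul, sub_zero] at hI
  have e : besselMoment 1 z - z * (besselMoment 0 z - besselMoment 2 z) = 0 := by
    rw [← hI, besselMoment, besselMoment, besselMoment,
      ← intervalIntegral.integral_sub ((by fun_prop : Continuous _).intervalIntegrable _ _)
        ((by fun_prop : Continuous _).intervalIntegrable _ _),
      ← intervalIntegral.integral_const_mul,
      ← intervalIntegral.integral_sub ((by fun_prop : Continuous _).intervalIntegrable _ _)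
        ((by fun_prop : Continuous _).intervalIntegrable _ _)]
    refine intervalIntegral.integral_congr fun θ _ => ?_
    linear_combination (z * Real.exp (z * Real.cos θ)) * Real.sin_sq_add_cos_sq θ
  linarith

theorem besselMoment_two_le (z : ℝ) : besselMoment 2 z ≤ besselMoment 0 z := by
  refine intervalIntegral.integral_mono_on (by linarith [Real.pi_pos])
    ((by fun_prop : Continuous _).intervalIntegrable _ _)
    ((by fun_prop : Continuous _).intervalIntegrable _ _) fun θ _ => ?_
  exact mul_le_mul_of_nonneg_right (by rw [pow_zero]; exact Real.cos_sq_le_one θ)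
    (Real.exp_pos _).le

/-- Cauchy–Schwarz: the integral of `(cos θ - t)²` against the exponential weight is nonnegative,
taken at its minimizer `t`. -/
theorem sq_besselMoment_one_le (z : ℝ) :
    besselMoment 1 z ^ 2 ≤ besselMoment 2 z * besselMoment 0 z := by
  have h0 := besselMoment_zero_pos z
  have key : ∀ t : ℝ, 0 ≤ besselMoment 2 z - 2 * t * besselMoment 1 z
      + t ^ 2 * besselMoment 0 z := by
    intro t
    have e : besselMoment 2 z - 2 * t * besselMoment 1 z + t ^ 2 * besselMoment 0 z
        = ∫ θ in (-Real.pi)..Real.pi, (Real.cos θ - t) ^ 2 * Real.exp (z * Real.cos θ) := by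
      rw [besselMoment, besselMoment, besselMoment,
        ← intervalIntegral.integral_const_mul, ← intervalIntegral.integral_const_mul,
        ← intervalIntegral.integral_sub ((by fun_prop : Continuous _).intervalIntegrable _ _)
          ((by fun_prop : Continuous _).intervalIntegrable _ _),
        ← intervalIntegral.integral_add ((by fun_prop : Continuous _).intervalIntegrable _ _)
          ((by fun_prop : Continuous _).intervalIntegrable _ _)]
      refine intervalIntegral.integral_congr fun θ _ => ?_
      ring
    rw [e]
    exact intervalIntegral.integral_nonneg (by linarith [Real.pi_pos]) fun θ _ => by positivity
  have h1 := key (besselMoment 1 z / besselMoment 0 z)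
  have h2 : besselMoment 2 z - 2 * (besselMoment 1 z / besselMoment 0 z) * besselMoment 1 z
      + (besselMoment 1 z / besselMoment 0 z) ^ 2 * besselMoment 0 z
      = (besselMoment 2 z * besselMoment 0 z - besselMoment 1 z ^ 2) / besselMoment 0 z := by
    field_simp
    ring
  rw [h2] at h1
  rw [le_div_iff₀ h0] at h1
  linarith

/-- The ratio `I₁ / I₀` of modified Bessel functions. -/
noncomputable def besselRatio (z : ℝ) : ℝ := besselMoment 1 z / besselMoment 0 z

theorem hasDerivAt_besselRatio {z : ℝ} (hz : 0 < z) :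
    HasDerivAt besselRatio (1 - besselRatio z ^ 2 - besselRatio z / z) z := by
  have h0 := besselMoment_zero_pos z
  refine ((hasDerivAt_besselMoment 1 z).div (hasDerivAt_besselMoment 0 z) h0.ne').congr_deriv ?_
  have h1 : besselMoment (1 + 1) z = besselMoment 0 z - besselMoment 1 z / z := by
    rw [besselMoment_one_eq]
    field_simp
    ring
  rw [h1, besselRatio]
  field_simp
  ring

/-- Cauchy–Schwarz combined with the recurrence. In view of the Riccati equation, it says that the
ratio has nonnegative derivative. -/
theorem besselRatio_div_le {z : ℝ} (hz : 0 < z) : besselRatio z / z ≤ 1 - besselRatio z ^ 2 := by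
  have h0 := besselMoment_zero_pos z
  have h1 : besselMoment 2 z = besselMoment 0 z - besselMoment 1 z / z := by
    rw [besselMoment_one_eq]
    field_simp
    ring
  have h2 := sq_besselMoment_one_le z
  rw [h1] at h2
  have e : 1 - besselRatio z ^ 2 - besselRatio z / z
      = ((besselMoment 0 z - besselMoment 1 z / z) * besselMoment 0 z - besselMoment 1 z ^ 2)
        / besselMoment 0 z ^ 2 := by
    rw [besselRatio]
    field_simp
    ring
  have : 0 ≤ 1 - besselRatio z ^ 2 - besselRatio z / z := by
    rw [e]
    exact div_nonneg (by linarith) (by positivity)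
  linarith

theorem besselRatio_nonneg {z : ℝ} (hz : 0 ≤ z) : 0 ≤ besselRatio z := by
  refine div_nonneg ?_ (besselMoment_zero_pos z).le
  rw [besselMoment_one_eq]
  exact mul_nonneg hz (sub_nonneg.2 (besselMoment_two_le z))

theorem continuous_besselRatio : Continuous besselRatio := by
  have hc : ∀ m, Continuous (besselMoment m) := fun m =>
    continuous_iff_continuousAt.2 fun z => (hasDerivAt_besselMoment m z).continuousAt
  exact (hc 1).div (hc 0) fun z => (besselMoment_zero_pos z).ne'

/-! ### Laplace's method. -/

theorem abs_cos_sub_le (θ : ℝ) : |Real.cos θ - 1 + θ ^ 2 / 2| ≤ θ ^ 4 := by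
  rcases le_or_gt |θ| 1 with h | h
  · have := Real.cos_bound h
    rw [show Real.cos θ - 1 + θ ^ 2 / 2 = Real.cos θ - (1 - θ ^ 2 / 2) by ring]
    have h4 : |θ| ^ 4 = θ ^ 4 := by rw [← abs_pow]; exact abs_of_nonneg (by positivity)
    rw [h4] at this
    nlinarith [sq_nonneg (θ ^ 2)]
  · have h2 : 1 ≤ θ ^ 2 := by
      rw [← sq_abs]
      nlinarith
    have h3 : 1 - θ ^ 2 / 2 ≤ Real.cos θ := Real.one_sub_sq_div_two_le_cos
    rw [abs_of_nonneg (by linarith)]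
    nlinarith [Real.cos_le_one θ]

theorem abs_exp_sub_exp_le {a b M : ℝ} (ha : a ≤ M) (hb : b ≤ M) :
    |Real.exp a - Real.exp b| ≤ |a - b| * Real.exp M := by
  wlog hab : b ≤ a generalizing a b
  · rw [abs_sub_comm, abs_sub_comm a]
    exact this hb ha (le_of_not_ge hab)
  rw [abs_of_nonneg (sub_nonneg.2 (Real.exp_le_exp.2 hab)), abs_of_nonneg (sub_nonneg.2 hab)]
  have h1 := Real.add_one_le_exp (b - a)
  have h2 : Real.exp b = Real.exp (b - a) * Real.exp a := by rw [← Real.exp_add]; ring_nf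
  have h3 := Real.exp_pos a
  have h4 : Real.exp a ≤ Real.exp M := Real.exp_le_exp.2 ha
  nlinarith

/-- Laplace's method for `I₀`. -/
theorem besselMoment_zero_asymptotic :
    (fun z => Real.sqrt z * Real.exp (-z) * besselMoment 0 z - Real.sqrt (2 * Real.pi))
      =O[atTop] fun z => 1 / z := by
  have hπ := Real.pi_pos
  -- From `cos θ ≤ 1 - (2 / π²) θ²` on `[-π, π]`. As `κ ≤ 1 / 2`, the same Gaussian also dominates
  -- `exp (-z θ² / 2)`.
  set κ := 2 / Real.pi ^ 2 with hκ
  have hκ0 : 0 < κ := by positivity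
  have hκ1 : κ ≤ 1 / 2 := by
    rw [hκ, div_le_iff₀ (by positivity)]
    nlinarith [Real.pi_gt_three]
  set g : ℝ → ℝ := fun x => x ^ 4 * Real.exp (-κ * x ^ 2) with hg
  have hgi : Integrable g := by
    have := integrable_rpow_mul_exp_neg_mul_sq hκ0 (s := 4) (by norm_num)
    refine this.congr (Eventually.of_forall fun x => ?_)
    simp only [hg]
    norm_cast
  refine IsBigO.of_bound (∫ x, g x) ?_
  filter_upwards [eventually_ge_atTop 1] with z hz
  have hz0 : 0 < z := by linarith
  have hsz := Real.sqrt_pos.2 hz0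
  have hsz2 : Real.sqrt z ^ 2 = z := Real.sq_sqrt hz0.le
  set F : ℝ → ℝ := (Ioc (-Real.pi) Real.pi).indicator
    fun θ => Real.exp (z * (Real.cos θ - 1)) with hF
  have hFi : Integrable F := by
    rw [hF, integrable_indicator_iff measurableSet_Ioc]
    exact ((by fun_prop : Continuous fun θ => Real.exp (z * (Real.cos θ - 1))).integrableOn_Icc).mono_set
      Ioc_subset_Icc_self
  have hGi : Integrable fun θ : ℝ => Real.exp (-(z / 2) * θ ^ 2) :=
    integrable_exp_neg_mul_sq (by positivity)
  -- The exponents differ by at most `z θ⁴`; outside the period only the Gaussian remains, and there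
  -- `z θ⁴ ≥ 1`. Under `x = √z θ` the bound has integral of order `z⁻¹ z^(-1/2)`.
  have hpt : ∀ θ, |F θ - Real.exp (-(z / 2) * θ ^ 2)| ≤ z⁻¹ * g (Real.sqrt z * θ) := by
    intro θ
    have hgz : z⁻¹ * g (Real.sqrt z * θ) = z * θ ^ 4 * Real.exp (-κ * (z * θ ^ 2)) := by
      simp only [hg, mul_pow, hsz2, show Real.sqrt z ^ 4 = (Real.sqrt z ^ 2) ^ 2 by ring]
      field_simp
    rw [hgz]
    have hb : -(z / 2) * θ ^ 2 ≤ -κ * (z * θ ^ 2) := by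
      nlinarith [mul_nonneg hz0.le (sq_nonneg θ)]
    by_cases hθ : θ ∈ Ioc (-Real.pi) Real.pi
    · rw [hF, indicator_of_mem hθ]
      have ha : z * (Real.cos θ - 1) ≤ -κ * (z * θ ^ 2) := by
        have := Real.cos_le_one_sub_mul_cos_sq (abs_le.2 ⟨hθ.1.le, hθ.2⟩)
        rw [← hκ] at this
        nlinarith
      refine (abs_exp_sub_exp_le ha hb).trans (mul_le_mul_of_nonneg_right ?_ (Real.exp_pos _).le)
      rw [show z * (Real.cos θ - 1) - -(z / 2) * θ ^ 2 = z * (Real.cos θ - 1 + θ ^ 2 / 2) by ring,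
        abs_mul, abs_of_pos hz0]
      exact mul_le_mul_of_nonneg_left (abs_cos_sub_le θ) hz0.le
    · rw [hF, indicator_of_notMem hθ, zero_sub, abs_neg, Real.abs_exp]
      have h1 : 1 ≤ θ ^ 2 := by
        rw [one_le_sq_iff_one_le_abs]
        by_contra! h
        have := abs_lt.1 h
        exact hθ ⟨by linarith [Real.pi_gt_three], by linarith [Real.pi_gt_three]⟩
      have h2 : 1 ≤ z * θ ^ 4 := by nlinarith [one_le_pow₀ h1 (n := 2), sq_nonneg (θ ^ 2)]
      calc Real.exp (-(z / 2) * θ ^ 2) ≤ 1 * Real.exp (-κ * (z * θ ^ 2)) := by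
            rw [one_mul]
            exact Real.exp_le_exp.2 hb
        _ ≤ _ := mul_le_mul_of_nonneg_right h2 (Real.exp_pos _).le
  have hdiff : |(∫ θ, F θ) - ∫ θ : ℝ, Real.exp (-(z / 2) * θ ^ 2)|
      ≤ z⁻¹ * ((Real.sqrt z)⁻¹ * ∫ x, g x) := by
    rw [← integral_sub hFi hGi, ← Real.norm_eq_abs]
    have hgs : Integrable fun θ => z⁻¹ * g (Real.sqrt z * θ) :=
      (hgi.comp_mul_left' hsz.ne').const_mul _
    refine (norm_integral_le_of_norm_le hgs (Eventually.of_forall hpt)).trans_eq ?_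
    rw [integral_const_mul, Measure.integral_comp_mul_left, abs_of_pos (inv_pos.2 hsz), smul_eq_mul]
  have hFI : ∫ θ, F θ = Real.exp (-z) * besselMoment 0 z := by
    rw [hF, integral_indicator measurableSet_Ioc, besselMoment,
      ← intervalIntegral.integral_of_le (by linarith), ← intervalIntegral.integral_const_mul]
    refine intervalIntegral.integral_congr fun θ _ => ?_
    simp only [pow_zero, one_mul]
    rw [← Real.exp_add]
    ring_nf
  have hGI : Real.sqrt z * ∫ θ : ℝ, Real.exp (-(z / 2) * θ ^ 2) = Real.sqrt (2 * Real.pi) := by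
    rw [integral_gaussian, ← Real.sqrt_mul hz0.le]
    congr 1
    field_simp
  rw [hFI] at hdiff
  rw [← hGI, mul_assoc, ← mul_sub, norm_mul, Real.norm_of_nonneg hsz.le, Real.norm_eq_abs,
    Real.norm_of_nonneg (by positivity)]
  calc _ ≤ Real.sqrt z * (z⁻¹ * ((Real.sqrt z)⁻¹ * ∫ x, g x)) :=
        mul_le_mul_of_nonneg_left hdiff hsz.le
    _ = _ := by field_simp

theorem log_besselMoment_zero_asymptotic :
    (fun z => Real.log (besselMoment 0 z / (2 * Real.pi))
      - (z - 1 / 2 * Real.log z - 1 / 2 * Real.log (2 * Real.pi))) =O[atTop] fun z => 1 / z := by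
  have hπ := Real.pi_pos
  have hpos : 0 < Real.sqrt (2 * Real.pi) := Real.sqrt_pos.2 (by positivity)
  have hlim : Tendsto (fun z => Real.sqrt z * Real.exp (-z) * besselMoment 0 z) atTop
      (𝓝 (Real.sqrt (2 * Real.pi))) := by
    have h1 : Tendsto (fun z : ℝ => 1 / z) atTop (𝓝 0) :=
      tendsto_const_nhds.div_atTop tendsto_id
    have := (besselMoment_zero_asymptotic.trans_tendsto h1).add_const (Real.sqrt (2 * Real.pi))
    simpa using this
  have hlog := (Real.hasDerivAt_log hpos.ne').isBigO_sub.comp_tendsto hlim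
  refine (hlog.trans besselMoment_zero_asymptotic).congr' ?_ EventuallyEq.rfl
  filter_upwards [eventually_gt_atTop 0] with z hz
  have h0 := besselMoment_zero_pos z
  have hsz := Real.sqrt_pos.2 hz
  simp only [Function.comp_apply]
  rw [Real.log_mul (by positivity) h0.ne', Real.log_mul hsz.ne' (Real.exp_pos _).ne', Real.log_exp,
    Real.log_sqrt hz.le, Real.log_sqrt (by positivity), Real.log_div h0.ne' (by positivity)]
  ring

/-! ### The sub-solution of the uniform measure. -/

theorem continuous_circlePoint : Continuous circlePoint := by
  refine Continuous.subtype_mk ?_ _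
  refine (PiLp.continuous_toLp 2 _).comp (continuous_pi fun i => ?_)
  fin_cases i
  · exact Real.continuous_cos
  · exact Real.continuous_sin

/-- Measure angles from the direction of `x`; periodicity removes the shift. -/
theorem integral_uniformCircle (x : E) (b : ℝ) :
    ∫ ν, Real.exp (b * inner ℝ x (ν : E)) ∂uniformCircle
      = besselMoment 0 (b * ‖x‖) / (2 * Real.pi) := by
  have hπ := Real.pi_pos
  set w : ℂ := ⟨x 0, x 1⟩ with hw
  have hnorm : ‖w‖ = ‖x‖ := by
    rw [EuclideanSpace.norm_eq, Complex.norm_eq_sqrt_sq_add_sq]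
    simp [hw]
  have h0 : x 0 = ‖x‖ * Real.cos w.arg := by
    rw [← hnorm, Complex.norm_mul_cos_arg]
  have h1 : x 1 = ‖x‖ * Real.sin w.arg := by
    rw [← hnorm, Complex.norm_mul_sin_arg]
  have hinner : ∀ θ, inner ℝ x (circlePoint θ : E) = ‖x‖ * Real.cos (θ - w.arg) := by
    intro θ
    rw [Real.cos_sub, PiLp.inner_apply, Fin.sum_univ_two]
    simp only [circlePoint, h0, h1]
    simp
    ring
  rw [uniformCircle, integral_smul_measure, integral_map continuous_circlePoint.aemeasurable
    (by fun_prop : Continuous fun ν : Metric.sphere (0 : E) 1 =>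
      Real.exp (b * inner ℝ x (ν : E))).aestronglyMeasurable,
    ENNReal.toReal_ofReal (by positivity), integral_Ico_eq_integral_Ioc,
    ← intervalIntegral.integral_of_le (by positivity)]
  simp only [hinner]
  have hper : Function.Periodic (fun θ => Real.exp (b * (‖x‖ * Real.cos θ))) (2 * Real.pi) :=
    fun θ => by simp only [Real.cos_add_two_pi]
  rw [intervalIntegral.integral_comp_sub_right (fun θ => Real.exp (b * (‖x‖ * Real.cos θ)))]
  have := hper.intervalIntegral_add_eq (0 - w.arg) (-Real.pi)
  rw [show 0 - w.arg + 2 * Real.pi = 2 * Real.pi - w.arg by ring,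
    show -Real.pi + 2 * Real.pi = Real.pi by ring] at this
  rw [this, smul_eq_mul, besselMoment, one_div_mul_eq_div]
  simp only [pow_zero, one_mul, mul_assoc]

namespace Params

variable {k σ c₀ c : ℝ}

/-- The slope of the Bessel sub-solution lies below the slope of the radial solution. -/
theorem besselRatio_le_slopeOf (h : Params k σ c₀ c) (hk : 0 < k) {s : ℝ → ℝ}
    (hs : IsAngleSine k c₀ c s) {r : ℝ} (hr : 0 < r) :
    k / σ * besselRatio (c₀ * k / 2 * r) ≤ slopeOf (s r) := by
  have hσ := h.σ_pos
  have hc := h.c_pos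
  have hc₀ := h.c₀_pos
  set m := k / σ with hm
  have hm0 : 0 < m := by positivity
  set n := c₀ * k / 2 with hn
  have hn0 : 0 < n := by positivity
  set w : ℝ → ℝ := fun r => m * besselRatio (n * r) with hw
  have hw0 : ∀ r, 0 ≤ r → 0 ≤ w r := fun r hr =>
    mul_nonneg hm0.le (besselRatio_nonneg (mul_nonneg hn0.le hr))
  have hpos : ∀ r, 0 < 1 + w r ^ 2 := fun r => by positivity
  have hcw : Continuous w := continuous_const.mul (continuous_besselRatio.comp (by fun_prop))
  have hwd : ∀ r, 0 < r → HasDerivAt w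
      (m * ((1 - besselRatio (n * r) ^ 2 - besselRatio (n * r) / (n * r)) * n)) r := by
    intro r hr
    have h1 : HasDerivAt (fun r => n * r) n r := by simpa using (hasDerivAt_id r).const_mul n
    exact ((hasDerivAt_besselRatio (mul_pos hn0 hr)).comp r h1).const_mul m
  set t : ℝ → ℝ := fun r => w r / Real.sqrt (1 + w r ^ 2) with ht
  have htsq : ∀ r, Real.sqrt (1 - t r ^ 2) = 1 / Real.sqrt (1 + w r ^ 2) := by
    intro r
    rw [show t r ^ 2 = w r ^ 2 / (1 + w r ^ 2) by
      simp only [ht]; rw [div_pow, Real.sq_sqrt (hpos r).le],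
      show 1 - w r ^ 2 / (1 + w r ^ 2) = (1 + w r ^ 2)⁻¹ by field_simp [(hpos r).ne']; ring,
      Real.sqrt_inv, one_div]
  have hslope : ∀ r, slopeOf (t r) = w r := by
    intro r
    have := (Real.sqrt_pos.2 (hpos r)).ne'
    rw [slopeOf, htsq]
    simp only [ht]
    field_simp
  have htd : ∀ r, 0 < r → HasDerivAt t
      (m * ((1 - besselRatio (n * r) ^ 2 - besselRatio (n * r) / (n * r)) * n)
        / ((1 + w r ^ 2) * Real.sqrt (1 + w r ^ 2))) r := by
    intro r hr
    have h1 := hwd r hr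
    set w' := m * ((1 - besselRatio (n * r) ^ 2 - besselRatio (n * r) / (n * r)) * n)
    have h2 : HasDerivAt (fun r => Real.sqrt (1 + w r ^ 2))
        (2 * w r * w' / (2 * Real.sqrt (1 + w r ^ 2))) r := by
      refine (((h1.pow 2).const_add 1).sqrt (hpos r).ne').congr_deriv ?_
      simp
    have h3 := Real.sqrt_pos.2 (hpos r)
    have h4 := Real.sq_sqrt (hpos r).le
    refine (h1.div h2 h3.ne').congr_deriv ?_
    have h5 := hpos r
    set a := Real.sqrt (1 + w r ^ 2)
    rw [← h4]
    field_simp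
    linear_combination w' * h4
  have hb : 1 / σ = Real.sqrt (1 + m ^ 2) := by
    rw [eq_comm, Real.sqrt_eq_iff_mul_self_eq_of_pos (by positivity), hm]
    field_simp
    linarith [h.sq_add_sq]
  have hsub : ∀ r, 0 < r → m * ((1 - besselRatio (n * r) ^ 2 - besselRatio (n * r) / (n * r)) * n)
        / ((1 + w r ^ 2) * Real.sqrt (1 + w r ^ 2))
      ≤ c * Real.sqrt (1 - t r ^ 2) - c₀ - t r / r := by
    intro r hr
    have hz : 0 < n * r := mul_pos hn0 hr
    have hρ0 := besselRatio_nonneg hz.le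
    have hρ := besselRatio_div_le hz
    have hwr : w r = m * besselRatio (n * r) := rfl
    have ha := Real.sqrt_pos.2 (hpos r)
    have ha2 := Real.sq_sqrt (hpos r).le
    rw [htsq, div_le_iff₀ (mul_pos (hpos r) ha)]
    simp only [ht]
    set ρ := besselRatio (n * r)
    set a := Real.sqrt (1 + w r ^ 2) with hadef
    set b := Real.sqrt (1 + m ^ 2) with hbdef
    have hb2 : b ^ 2 = 1 + m ^ 2 := Real.sq_sqrt (by positivity)
    have hρ1 : ρ ^ 2 ≤ 1 := by
      have : 0 ≤ ρ / (n * r) := div_nonneg hρ0 hz.le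
      linarith
    have hab : a ≤ b := Real.sqrt_le_sqrt (by rw [hwr]; nlinarith [sq_nonneg m])
    have hcb : c = c₀ * b := by rw [← hb, ← h.c_mul]; field_simp
    have hmb : m = k * b := by rw [← hb, hm]; ring
    have e1 : (c * (1 / a) - c₀ - w r / a / r) * ((1 + w r ^ 2) * a)
        = a ^ 2 * (c₀ * (b - a)) - a ^ 2 * (m * n * (ρ / (n * r))) := by
      rw [hwr, ← hwr, ← ha2, hcb, hwr]
      field_simp
    rw [e1]
    have h6 : m ^ 2 * (1 - ρ ^ 2) = (b - a) * (a + b) := by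
      have : a ^ 2 = 1 + m ^ 2 * ρ ^ 2 := by rw [ha2, hwr]; ring
      linear_combination this - hb2
    -- By `h6`, `m² (1 - ρ²) = (b - a)(a + b)`, and `a + b ≤ 2 b`. The exponent `n = c₀ k / 2` is
    -- such that `2 n b = c₀ m`.
    have h7 : m * n * (1 - ρ ^ 2) ≤ c₀ * (b - a) := by
      have h8 : n * (a + b) ≤ c₀ * m := by
        rw [hn, hmb]
        nlinarith [mul_pos hc₀ hk]
      have h9 : 0 ≤ b - a := sub_nonneg.2 hab
      have h10 : m * (m * n * (1 - ρ ^ 2)) ≤ m * (c₀ * (b - a)) := by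
        calc m * (m * n * (1 - ρ ^ 2)) = n * (a + b) * (b - a) := by linear_combination n * h6
          _ ≤ c₀ * m * (b - a) := mul_le_mul_of_nonneg_right h8 h9
          _ = _ := by ring
      exact le_of_mul_le_mul_left h10 hm0
    have h11 : a ^ 2 * (m * n * (1 - ρ ^ 2)) ≤ a ^ 2 * (c₀ * (b - a)) :=
      mul_le_mul_of_nonneg_left h7 (sq_nonneg a)
    -- After `a² = 1 + m² ρ²` is inserted, what is left to absorb is `m² ρ²` times the right-hand
    -- side of the Riccati equation, nonnegative by Cauchy–Schwarz.
    have h12 : m ^ 2 * ρ ^ 2 * (m * n * (ρ / (n * r))) ≤ m ^ 2 * ρ ^ 2 * (m * n * (1 - ρ ^ 2)) :=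
      mul_le_mul_of_nonneg_left (mul_le_mul_of_nonneg_left hρ (by positivity)) (by positivity)
    have h13 : a ^ 2 = 1 + m ^ 2 * ρ ^ 2 := by rw [ha2, hwr]; ring
    rw [h13] at h11 ⊢
    linarith
  have htc : Continuous t := hcw.div (by fun_prop) fun r => (Real.sqrt_pos.2 (hpos r)).ne'
  have hle := sub_le_super (c₀ := c₀) hc.le htc.continuousOn hs.continuousOn
    (fun r hr => (hs.mem r hr.le).1) htd hs.hasDerivAt hsub (fun r _ => le_rfl) hr
  have := h.slopeOf_mono (div_nonneg (hw0 r hr.le) (Real.sqrt_nonneg _)) hle (hs.mem r hr.le).2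
  rwa [hslope] at this

/-- The radial profile of the sub-solution attached to the uniform measure. -/
noncomputable def besselProfile (k σ c₀ r : ℝ) : ℝ :=
  -(2 / (c₀ * σ)) * Real.log (besselMoment 0 (c₀ * k / 2 * r) / (2 * Real.pi))

theorem hasDerivAt_besselProfile (h : Params k σ c₀ c) (r : ℝ) :
    HasDerivAt (besselProfile k σ c₀) (-(k / σ * besselRatio (c₀ * k / 2 * r))) r := by
  have h0 := besselMoment_zero_pos (c₀ * k / 2 * r)
  have hπ := Real.pi_pos
  have hσ := h.σ_pos
  have hc₀ := h.c₀_pos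
  have h1 : HasDerivAt (fun r => c₀ * k / 2 * r) (c₀ * k / 2) r := by
    simpa using (hasDerivAt_id r).const_mul (c₀ * k / 2)
  have h2 := ((hasDerivAt_besselMoment 0 (c₀ * k / 2 * r)).comp r h1).div_const (2 * Real.pi)
  refine ((h2.log (div_pos h0 (by positivity)).ne').const_mul _).congr_deriv ?_
  simp only [Function.comp_apply, besselRatio, zero_add]
  field_simp

/-- The constant is `ln (2 π n) / (c₀ σ)` with `n = c₀ k / 2`, collected from the terms `-½ ln n`
and `-½ ln (2 π)` of `ln I₀`. -/
theorem besselProfile_expansion (h : Params k σ c₀ c) (hk : 0 < k) :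
    (fun r => besselProfile k σ c₀ r - (-(k / σ) * r + 1 / (c₀ * σ) * Real.log r
      + Real.log (Real.pi * c₀ * k) / (c₀ * σ))) =O[atTop] fun r => 1 / r := by
  have hπ := Real.pi_pos
  have hσ := h.σ_pos
  have hc₀ := h.c₀_pos
  set n := c₀ * k / 2 with hn
  have hn0 : 0 < n := by positivity
  have hlim : Tendsto (fun r => n * r) atTop atTop := tendsto_id.const_mul_atTop hn0
  have h1 := (log_besselMoment_zero_asymptotic.comp_tendsto hlim).const_mul_left (-(2 / (c₀ * σ)))
  have h2 : ((fun z : ℝ => 1 / z) ∘ fun r => n * r) =O[atTop] fun r : ℝ => 1 / r := by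
    refine ((isBigO_refl (fun r : ℝ => 1 / r) atTop).const_mul_left (1 / n)).congr_left fun r => ?_
    simp only [Function.comp_apply]
    rw [one_div_mul_one_div]
  refine (h1.trans h2).congr' ?_ EventuallyEq.rfl
  filter_upwards [eventually_gt_atTop 0] with r hr
  simp only [Function.comp_apply, besselProfile, ← hn]
  rw [Real.log_mul hn0.ne' hr.ne', show Real.pi * c₀ * k = n * (2 * Real.pi) by rw [hn]; ring,
    Real.log_mul hn0.ne' (by positivity)]
  generalize Real.log (besselMoment 0 (n * r) / (2 * Real.pi)) = A
  generalize Real.log n = B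
  rw [hn]
  field_simp
  ring

theorem isBigO_sub_besselProfile (h : Params k σ c₀ c) (hk : 0 < k) {f : ℝ → ℝ} {b : ℝ}
    (hf : (fun r => f r - (-(k / σ) * r + 1 / (c₀ * σ) * Real.log r
      + Real.log (Real.pi * c₀ * k) / (c₀ * σ) + b / r)) =O[atTop] fun r => 1 / r ^ 2) :
    (fun r => f r - besselProfile k σ c₀ r) =O[atTop] fun r => 1 / r := by
  have h1 : (fun r : ℝ => 1 / r ^ 2) =O[atTop] fun r => 1 / r := by
    simpa using isBigO_inv_pow_atTop one_le_two
  have h2 := (isBigO_refl (fun r : ℝ => 1 / r) atTop).const_mul_left b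
  refine (((hf.trans h1).add h2).sub (h.besselProfile_expansion hk)).congr_left fun r => ?_
  ring

/-- The difference is nonincreasing by the slope comparison and tends to `0` at infinity. -/
theorem besselProfile_le (h : Params k σ c₀ c) (hk : 0 < k) {s f : ℝ → ℝ}
    (hs : IsAngleSine k c₀ c s) (hf : ∀ r, 0 ≤ r → HasDerivAt f (-slopeOf (s r)) r)
    (hO : (fun r => f r - besselProfile k σ c₀ r) =O[atTop] fun r => 1 / r) {r : ℝ} (hr : 0 ≤ r) :
    besselProfile k σ c₀ r ≤ f r := by
  have hd : ∀ r, 0 ≤ r → HasDerivAt (fun r => f r - besselProfile k σ c₀ r)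
      (-slopeOf (s r) - -(k / σ * besselRatio (c₀ * k / 2 * r))) r := fun r hr =>
    (hf r hr).sub (h.hasDerivAt_besselProfile r)
  have hanti : AntitoneOn (fun r => f r - besselProfile k σ c₀ r) (Ici 0) := by
    refine antitoneOn_of_deriv_nonpos (convex_Ici 0)
      (fun r hr => (hd r hr).continuousAt.continuousWithinAt)
      (fun r hr => (hd r (interior_subset hr)).differentiableAt.differentiableWithinAt)
      fun r hr => ?_
    rw [(hd r (interior_subset hr)).deriv]
    rw [interior_Ici] at hr
    linarith [h.besselRatio_le_slopeOf hk hs hr]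
  have hlim : Tendsto (fun r => f r - besselProfile k σ c₀ r) atTop (𝓝 0) :=
    hO.trans_tendsto (tendsto_const_nhds.div_atTop tendsto_id)
  have : 0 ≤ f r - besselProfile k σ c₀ r := by
    refine le_of_tendsto hlim ?_
    filter_upwards [eventually_ge_atTop r] with x hx
    exact hanti hr (hr.trans hx) hx
  linarith

theorem isLittleO_of_expansion {m a b C : ℝ} {f : ℝ → ℝ}
    (hf : (fun r => f r - (m * r + a * Real.log r + C + b / r)) =O[atTop] fun r => 1 / r ^ 2) :
    (fun r => f r - m * r) =o[atTop] fun r => r := by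
  have h1 : (fun _ : ℝ => (1 : ℝ)) =o[atTop] fun r : ℝ => r := isLittleO_const_id_atTop 1
  have h2 : (fun r : ℝ => 1 / r ^ 2) =o[atTop] fun r => r := by
    refine IsBigO.trans_isLittleO ?_ h1
    simpa using isBigO_inv_pow_atTop (Nat.zero_le 2)
  have h3 : (fun r : ℝ => b / r) =o[atTop] fun r => r := by
    refine IsBigO.trans_isLittleO ?_ h1
    refine ((isBigO_inv_pow_atTop (Nat.zero_le 1)).const_mul_left b).congr (fun r => ?_) fun r => ?_
    · rw [pow_one, mul_one_div]
    · simp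
  have h4 : (fun r : ℝ => a * Real.log r) =o[atTop] fun r => r :=
    Real.isLittleO_log_id_atTop.const_mul_left a
  have h5 : (fun _ : ℝ => C) =o[atTop] fun r : ℝ => r := isLittleO_const_id_atTop C
  refine (((hf.trans_isLittleO h2).add h4).add (h5.add h3)).congr_left fun r => ?_
  ring

end Params

/-! ### Transfer from profiles to solutions on the plane. -/

theorem gradient_add_const (φ : E → ℝ) (κ : ℝ) :
    gradient (fun x => φ x + κ) = gradient φ := by
  funext x
  rw [gradient, gradient, fderiv_add_const]

theorem IsSolutionOn.add_const {c₀ c : ℝ} {φ : E → ℝ} {U : Set E} (h : IsSolutionOn c₀ c φ U)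
    (κ : ℝ) : IsSolutionOn c₀ c (fun x => φ x + κ) U := by
  refine ⟨h.1.add contDiffOn_const, fun x hx => ?_⟩
  rw [← h.2 x hx, mcmOperator, gradient_add_const]
  rfl

/-- A smooth radial solution `φ = f(|x|)` together with the sine `s` of its angle. -/
structure IsSmoothRadialSolution (k c₀ c : ℝ) (φ : E → ℝ) (f s : ℝ → ℝ) : Prop where
  isAngleSine : IsAngleSine k c₀ c s
  contDiff : ContDiff ℝ ∞ φ
  isSolutionOn : IsSolutionOn c₀ c φ univ
  eq_norm : ∀ x, φ x = f ‖x‖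
  hasDerivAt : ∀ r, 0 ≤ r → HasDerivAt f (-slopeOf (s r)) r
  zero : s 0 = 0
  norm_gradient : ∀ x, ‖gradient φ x‖ = slopeOf (s ‖x‖)

theorem IsSmoothRadialSolution.add_const {k c₀ c : ℝ} {φ : E → ℝ} {f s : ℝ → ℝ}
    (h : IsSmoothRadialSolution k c₀ c φ f s) (κ : ℝ) :
    IsSmoothRadialSolution k c₀ c (fun x => φ x + κ) (fun r => f r + κ) s where
  isAngleSine := h.isAngleSine
  contDiff := h.contDiff.add contDiff_const
  isSolutionOn := h.isSolutionOn.add_const κ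
  eq_norm x := by rw [h.eq_norm]
  hasDerivAt r hr := (h.hasDerivAt r hr).add_const κ
  zero := h.zero
  norm_gradient x := by rw [gradient_add_const, h.norm_gradient]

theorem params_of_angle {α c₀ c : ℝ} (hα : α ∈ Ioc 0 (Real.pi / 2)) (hc₀ : 0 < c₀)
    (hc : c = c₀ / Real.sin α) : Params (Real.cos α) (Real.sin α) c₀ c where
  k_nonneg := Real.cos_nonneg_of_mem_Icc ⟨by linarith [hα.1, Real.pi_pos], hα.2⟩
  σ_pos := Real.sin_pos_of_mem_Ioo ⟨hα.1, by linarith [hα.2, Real.pi_pos]⟩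
  sq_add_sq := Real.sin_sq_add_cos_sq α
  c₀_pos := hc₀
  c_mul := by
    have : 0 < Real.sin α := Real.sin_pos_of_mem_Ioo ⟨hα.1, by linarith [hα.2, Real.pi_pos]⟩
    rw [hc]
    field_simp

theorem hasConeExpansion_iff {α c₀ C : ℝ} {φ : E → ℝ} {f : ℝ → ℝ} (hf : ∀ x, φ x = f ‖x‖) :
    HasConeExpansion α c₀ C φ ↔
      (fun r => f r - (-(Real.cos α / Real.sin α) * r + 1 / (c₀ * Real.sin α) * Real.log r + C
        + (2 - 3 * Real.sin α ^ 2) / (c₀ ^ 2 * (2 * Real.sin α * Real.cos α) * r)))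
        =O[atTop] fun r => 1 / r ^ 2 := by
  rw [HasConeExpansion]
  simp only [hf, Real.cot_eq_cos_div_sin, Real.sin_two_mul]
  constructor
  · intro h
    have hnorm : ∀ r : ℝ, ‖(EuclideanSpace.single 0 r : E)‖ = |r| := fun r => by simp
    have hlim : Tendsto (fun r : ℝ => (EuclideanSpace.single 0 r : E)) atTop
        (Bornology.cobounded E) := by
      rw [← tendsto_norm_atTop_iff_cobounded]
      simp only [hnorm]
      exact tendsto_abs_atTop_atTop
    refine (h.comp_tendsto hlim).congr' ?_ ?_ <;>
    · filter_upwards [eventually_ge_atTop 0] with r hr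
      simp only [Function.comp_apply, hnorm, abs_of_nonneg hr]
  · exact fun h => h.comp_tendsto tendsto_norm_cobounded_atTop

namespace IsSmoothRadialSolution

variable {α c₀ c : ℝ} {φ : E → ℝ} {f s : ℝ → ℝ}

theorem eq_const (h : IsSmoothRadialSolution 0 c₀ c φ f s) {r : ℝ} (hr : 0 ≤ r) : f r = f 0 := by
  refine constant_of_has_deriv_right_zero (a := 0) (b := r)
    (fun x hx => (h.hasDerivAt x hx.1).continuousAt.continuousWithinAt) (fun x hx => ?_) r
    ⟨hr, le_rfl⟩
  have hs := h.isAngleSine.mem x hx.1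
  have h0 : s x = 0 := le_antisymm hs.2 hs.1
  have := h.hasDerivAt x hx.1
  rw [h0, slopeOf, zero_div, neg_zero] at this
  exact this.hasDerivWithinAt

theorem exists_hasConeExpansion (h : IsSmoothRadialSolution (Real.cos α) c₀ c φ f s)
    (hp : Params (Real.cos α) (Real.sin α) c₀ c) (hk : 0 < Real.cos α) :
    ∃ C, HasConeExpansion α c₀ C φ := by
  obtain ⟨C, hC⟩ := hp.exists_radial_expansion hk h.isAngleSine h.hasDerivAt
  exact ⟨C, (hasConeExpansion_iff h.eq_norm).2 hC⟩

theorem isRadialConeSolution (h : IsSmoothRadialSolution (Real.cos α) c₀ c φ f s)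
    (hp : Params (Real.cos α) (Real.sin α) c₀ c) : IsRadialConeSolution α c₀ c φ where
  solution := ⟨h.isSolutionOn.1.mono (subset_univ _),
    fun x _ => h.isSolutionOn.2 x trivial⟩
  radial := ⟨f, h.eq_norm, by
    have := h.hasDerivAt 0 le_rfl
    rw [h.zero, slopeOf, zero_div, neg_zero] at this
    exact this.hasDerivWithinAt⟩
  asymptotic := by
    rw [IsAsymptoticToCone, Real.cot_eq_cos_div_sin]
    suffices (fun r => f r - (-(Real.cos α / Real.sin α) * r)) =o[atTop] fun r => r by
      simp only [h.eq_norm]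
      exact this.comp_tendsto tendsto_norm_cobounded_atTop
    rcases hp.k_nonneg.eq_or_lt with h0 | hk
    · rw [← h0] at h ⊢
      refine (isLittleO_const_id_atTop (f 0)).congr' ?_ EventuallyEq.rfl
      filter_upwards [eventually_ge_atTop 0] with r hr
      rw [h.eq_const hr]
      ring
    · obtain ⟨C, hC⟩ := hp.exists_radial_expansion hk h.isAngleSine h.hasDerivAt
      refine Params.isLittleO_of_expansion (a := 1 / (c₀ * Real.sin α)) (C := C)
        (b := (2 - 3 * Real.sin α ^ 2) / (c₀ ^ 2 * (2 * Real.sin α * Real.cos α))) ?_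
      exact hC.congr_left fun r => by rw [div_div]

theorem phiStar_le_and_isBigO (h : IsSmoothRadialSolution (Real.cos α) c₀ c φ f s)
    (hp : Params (Real.cos α) (Real.sin α) c₀ c) (hk : 0 < Real.cos α)
    (hexp : HasConeExpansion α c₀
      (Real.log (Real.pi * c₀ * Real.cos α) / (c₀ * Real.sin α)) φ) :
    (∀ x, phiStar α c₀ uniformCircle x ≤ φ x) ∧
      (fun x => φ x - phiStar α c₀ uniformCircle x) =O[Bornology.cobounded E]
        fun x => 1 / Real.sqrt ‖x‖ := by
  have hstar : ∀ x : E, phiStar α c₀ uniformCircle x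
      = Params.besselProfile (Real.cos α) (Real.sin α) c₀ ‖x‖ := fun x => by
    rw [phiStar, integral_uniformCircle, Params.besselProfile]
  rw [hasConeExpansion_iff h.eq_norm] at hexp
  have hO := hp.isBigO_sub_besselProfile hk (f := f)
    (b := (2 - 3 * Real.sin α ^ 2) / (c₀ ^ 2 * (2 * Real.sin α * Real.cos α)))
    (hexp.congr_left fun r => by rw [div_div])
  refine ⟨fun x => ?_, ?_⟩
  · rw [hstar, h.eq_norm]
    exact hp.besselProfile_le hk h.isAngleSine h.hasDerivAt hO (norm_nonneg x)
  -- The profiles agree to order `1 / r`, which is stronger than the rate required.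
  · have hsqrt : (fun r : ℝ => 1 / r) =O[atTop] fun r => 1 / Real.sqrt r := by
      refine IsBigO.of_bound 1 ?_
      filter_upwards [eventually_ge_atTop 1] with r hr
      have hr0 : 0 < r := by linarith
      have hs0 := Real.sqrt_pos.2 hr0
      rw [Real.norm_of_nonneg (by positivity), Real.norm_of_nonneg (by positivity), one_mul]
      refine one_div_le_one_div_of_le hs0 ?_
      rw [Real.sqrt_le_left hr0.le]
      nlinarith
    simp only [hstar, h.eq_norm]
    exact (hO.trans hsqrt).comp_tendsto tendsto_norm_cobounded_atTop

end IsSmoothRadialSolution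

end ForcedMC

theorem lemma7p2 (α c₀ c : ℝ) (hα : α ∈ Set.Ioc 0 (Real.pi / 2)) (hc₀ : 0 < c₀)
    (hc : c = c₀ / Real.sin α) :
    -- existence
    (∃ φ : EuclideanSpace ℝ (Fin 2) → ℝ, ForcedMC.IsRadialConeSolution α c₀ c φ) ∧
    -- uniqueness up to an additive constant
    (∀ φ ψ : EuclideanSpace ℝ (Fin 2) → ℝ,
      ForcedMC.IsRadialConeSolution α c₀ c φ → ForcedMC.IsRadialConeSolution α c₀ c ψ →
        ∃ k : ℝ, ∀ x, ψ x = φ x + k) ∧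
    -- smooth solution on the whole plane, concavity, gradient bound
    (∀ φ : EuclideanSpace ℝ (Fin 2) → ℝ, ForcedMC.IsRadialConeSolution α c₀ c φ →
      ContDiff ℝ (⊤ : ℕ∞) φ ∧ ForcedMC.IsSolutionOn c₀ c φ Set.univ ∧
      ConcaveOn ℝ Set.univ φ ∧ ∀ x, ‖gradient φ x‖ ≤ Real.cot α) ∧
    -- the degenerate case
    (α = Real.pi / 2 →
      ∀ φ : EuclideanSpace ℝ (Fin 2) → ℝ, ForcedMC.IsRadialConeSolution α c₀ c φ →
        ∃ k : ℝ, ∀ x, φ x = k) ∧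
    -- the expansion at infinity, and the comparison with the sub-solution
    (α ≠ Real.pi / 2 →
      (∀ φ : EuclideanSpace ℝ (Fin 2) → ℝ, ForcedMC.IsRadialConeSolution α c₀ c φ →
        ∃ C : ℝ, ForcedMC.HasConeExpansion α c₀ C φ) ∧
      (∃ φ : EuclideanSpace ℝ (Fin 2) → ℝ, ForcedMC.IsRadialConeSolution α c₀ c φ ∧
        ForcedMC.HasConeExpansion α c₀
          (Real.log (Real.pi * c₀ * Real.cos α) / (c₀ * Real.sin α)) φ) ∧
      (∀ φ : EuclideanSpace ℝ (Fin 2) → ℝ, ForcedMC.IsRadialConeSolution α c₀ c φ →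
        ForcedMC.HasConeExpansion α c₀
          (Real.log (Real.pi * c₀ * Real.cos α) / (c₀ * Real.sin α)) φ →
        (∀ x, ForcedMC.phiStar α c₀ ForcedMC.uniformCircle x ≤ φ x) ∧
        Asymptotics.IsBigO (Bornology.cobounded (EuclideanSpace ℝ (Fin 2)))
          (fun x => φ x - ForcedMC.phiStar α c₀ ForcedMC.uniformCircle x)
          (fun x => 1 / Real.sqrt ‖x‖))) := by

  have hp := ForcedMC.params_of_angle hα hc₀ hc
  obtain ⟨φ₀, f₀, s, h1, h2, h3, h4, h5, h6, h7⟩ := hp.exists_solution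
  have h₀ : ForcedMC.IsSmoothRadialSolution (Real.cos α) c₀ c φ₀ f₀ s := ⟨h1, h2, h3, h4, h5, h6, h7⟩
  have huniq : ∀ φ ψ : EuclideanSpace ℝ (Fin 2) → ℝ,
      ForcedMC.IsRadialConeSolution α c₀ c φ → ForcedMC.IsRadialConeSolution α c₀ c ψ →
        ∃ k : ℝ, ∀ x, ψ x = φ x + k := fun φ ψ hφ hψ =>
    ForcedMC.radial_solution_unique hc₀ hp.c_pos hφ.solution hφ.radial hψ.solution hψ.radial
  -- Every radial cone solution is a vertical translate of `φ₀`, with the same `s`.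
  have hall : ∀ φ : EuclideanSpace ℝ (Fin 2) → ℝ, ForcedMC.IsRadialConeSolution α c₀ c φ →
      ∃ f, ForcedMC.IsSmoothRadialSolution (Real.cos α) c₀ c φ f s := fun φ hφ => by
    obtain ⟨κ, hκ⟩ := huniq φ₀ φ (h₀.isRadialConeSolution hp) hφ
    rw [funext hκ]
    exact ⟨_, h₀.add_const κ⟩
  refine ⟨⟨φ₀, h₀.isRadialConeSolution hp⟩, huniq, fun φ hφ => ?_, fun hα2 φ hφ => ?_,
    fun hα2 => ?_⟩
  · obtain ⟨f, h⟩ := hall φ hφ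
    refine ⟨h.contDiff, h.isSolutionOn, ?_, fun x => ?_⟩
    · rw [funext h.eq_norm]
      exact hp.concaveOn_of_hasDerivAt h.isAngleSine h.hasDerivAt
    · rw [h.norm_gradient, Real.cot_eq_cos_div_sin]
      exact hp.slopeOf_le (h.isAngleSine.mem _ (norm_nonneg x))
  · obtain ⟨f, h⟩ := hall φ hφ
    rw [hα2, Real.cos_pi_div_two] at h
    exact ⟨f 0, fun x => by rw [h.eq_norm, h.eq_const (norm_nonneg x)]⟩
  · have hk : 0 < Real.cos α :=
      Real.cos_pos_of_mem_Ioo ⟨by linarith [hα.1, Real.pi_pos], lt_of_le_of_ne hα.2 hα2⟩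
    refine ⟨fun φ hφ => ?_, ?_, fun φ hφ hexp => ?_⟩
    · obtain ⟨f, h⟩ := hall φ hφ
      exact h.exists_hasConeExpansion hp hk
    · obtain ⟨C, hC⟩ := h₀.exists_hasConeExpansion hp hk
      -- Translating `φ₀` by `C₀ - C` replaces its constant `C` by `C₀`.
      have h := h₀.add_const (Real.log (Real.pi * c₀ * Real.cos α) / (c₀ * Real.sin α) - C)
      refine ⟨_, h.isRadialConeSolution hp, ?_⟩
      refine hC.congr_left fun x => ?_
      ring
    · obtain ⟨f, h⟩ := hall φ hφ
      exact h.phiStar_le_and_isBigO hp hk hexp
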